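/- Let $(N,\langle\cdot,\cdot\rangle)$ be a smooth, time-oriented four-dimensional Lorentzian manifold of signature $(-,+,+,+)$, let $\Sigma$ be a closed (compact, without boundary) smooth 2-manifold, and let $\Phi:\Sigma\to N$ be a smooth embedding with spacelike image; identify $\Sigma$ with $\Phi(\Sigma)$. The normal bundle $T^\perp\Sigma$ then carries an induced metric of signature $(-,+)$, so that the spacelike vectors of each fiber form two opposite quadrants. Assume that an outward direction of $\Sigma$ is given, i.e. a continuous choice of one of these two quadrants in each fiber (as given by a smooth spacelike normal field), whose elements are called outward-spacelike. Let $w\mapsto w^\perp$ be the involution of $T^\perp\Sigma$ that, in each fiber, is the linear map exchanging $u$ and $v$ for an orthonormal basis $(u,v)$ with $u$ future-timelike and $v$ outward-spacelike. Let $\nabla^\perp$ be the connection on $T^\perp\Sigma$ obtained by projecting the Levi-Civita connection of $N$ orthogonally onto $T^\perp\Sigma$. For a smooth, unit-length, outward-spacelike section $\nu$ of $T^\perp\Sigma$ let $\alpha_\nu$ be its connection 1-form, $$\alpha_\nu(X)=\langle\nabla^\perp_X\nu,\nu^\perp\rangle\qquad (X\in T\Sigma),$$ and put $$\mathcal C(\nu)=\int_\Sigma|\alpha_\nu|^2\,dA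 ,$$ where the norm $|\cdot|$, the area measure $dA$ and the divergence $\operatorname{div}_\Sigma$ are those of the Riemannian metric induced on $\Sigma$. **Proposition.** Let $\nu$ be a smooth, unit-length, outward-spacelike section of $T^\perp\Sigma$. Then $\nu$ minimizes $\mathcal C$ among all smooth, unit-length, outward-spacelike sections of $T^\perp\Sigma$ if and only if $\operatorname{div}_\Sigma(\alpha_\nu)=0$ on $\Sigma$. -/

import Mathlib

open Set MeasureTheory Bundle
open scoped Manifold ContDiff

noncomputable section

namespace StraightOut

/-- The coordinate space `ℝⁿ` with its Euclidean structure. -/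
abbrev Coord (n : ℕ) : Type := EuclideanSpace ℝ (Fin n)

/-! ### Tensor fields in the coordinates of a chart -/

section Charts

variable {n : ℕ} {M : Type*} [TopologicalSpace M] [ChartedSpace (Coord n) M]

/-- Fields of bilinear forms on the tangent spaces of `M`. -/
abbrev BilinField (n : ℕ) (M : Type*) [TopologicalSpace M] [ChartedSpace (Coord n) M] : Type _ :=
  ∀ x : M, TangentSpace (𝓡 n) x →L[ℝ] TangentSpace (𝓡 n) x →L[ℝ] ℝ

/-- 1-forms on `M`. -/
abbrev OneForm (n : ℕ) (M : Type*) [TopologicalSpace M] [ChartedSpace (Coord n) M] : Type _ :=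
  ∀ x : M, TangentSpace (𝓡 n) x →L[ℝ] ℝ

variable [IsManifold (𝓡 n) ∞ M]

/-- The coordinate frame, at `x`, of the preferred chart around `x₀`: it sends `c ∈ ℝⁿ` to the
tangent vector `∑ cⁱ ∂ᵢ` at `x`. (The trivialization of the tangent bundle attached to `x₀` is the
derivative of that chart.) -/
def frame (x₀ x : M) : Coord n →L[ℝ] TangentSpace (𝓡 n) x :=
  (trivializationAt (Coord n) (TangentSpace (𝓡 n)) x₀).symmL ℝ x

/-- The components of a tangent vector at `x` in the preferred chart around `x₀`. -/
def comps (x₀ x : M) : TangentSpace (𝓡 n) x →L[ℝ] Coord n :=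
  (trivializationAt (Coord n) (TangentSpace (𝓡 n)) x₀).continuousLinearMapAt ℝ x

/-- The components `b_{ij}(y)` of a field of bilinear forms in the preferred chart `φ` around `x₀`,
as a function of `y = φ(x)`, bundled as a bilinear form on `ℝⁿ`. -/
def bilinCoord (b : BilinField n M) (x₀ : M) (y : Coord n) : Coord n →L[ℝ] Coord n →L[ℝ] ℝ :=
  let x := (extChartAt (𝓡 n) x₀).symm y
  (ContinuousLinearMap.precomp ℝ (frame x₀ x)) ∘L (b x) ∘L (frame x₀ x)

/-- The components of a 1-form in the preferred chart `φ` around `x₀`, as a function of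
`y = φ(x)`. -/
def formCoord (a : OneForm n M) (x₀ : M) (y : Coord n) : Coord n →L[ℝ] ℝ :=
  let x := (extChartAt (𝓡 n) x₀).symm y
  (a x) ∘L (frame x₀ x)

/-! ### The Levi-Civita connection -/

set_option synthInstance.maxHeartbeats 200000 in
/-- The Christoffel symbols of the first kind of the metric `b`, at `x₀`, in the preferred chart
around `x₀`:
`christoffelLower b x₀ v u w = ½ (∂_u b(v, w) + ∂_v b(u, w) - ∂_w b(v, u))`. -/
def christoffelLower (b : BilinField n M) (x₀ : M) (v : Coord n) :
    Coord n →L[ℝ] Coord n →L[ℝ] ℝ :=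
  let D : Coord n →L[ℝ] Coord n →L[ℝ] Coord n →L[ℝ] ℝ :=
    fderiv ℝ (bilinCoord b x₀) (extChartAt (𝓡 n) x₀ x₀)
  (1 / 2 : ℝ) • (D.flip v + D v - (D.flip v).flip)

/-- The Christoffel symbols (of the second kind) of the Levi-Civita connection of the nondegenerate
metric `b`, at `x₀`, in the preferred chart around `x₀`: `christoffel b x₀ v u` has the components
`Γᵏᵢⱼ uⁱ vʲ`. -/
def christoffel (b : BilinField n M) (x₀ : M) (v : Coord n) : Coord n →L[ℝ] Coord n :=
  (bilinCoord b x₀ (extChartAt (𝓡 n) x₀ x₀)).inverse ∘L christoffelLower b x₀ v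

/-! ### Riemannian surfaces: area, sharp, norm and divergence of 1-forms -/

/-- The vector field dual to the 1-form `a` with respect to the metric `h`. -/
def sharp (h : BilinField n M) (a : OneForm n M) (x : M) : TangentSpace (𝓡 n) x :=
  (h x).inverse (a x)

/-- The pointwise squared norm `|a|² = hⁱʲ aᵢ aⱼ` of a 1-form with respect to the metric `h`. -/
def normSq (h : BilinField n M) (a : OneForm n M) (x : M) : ℝ :=
  a x (sharp h a x)

/-- The density `√(det hᵢⱼ)` of `h` in the preferred chart around `x₀`. -/
def density (h : BilinField n M) (x₀ : M) (y : Coord n) : ℝ :=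
  √ (Matrix.det (Matrix.of fun i j : Fin n =>
    bilinCoord h x₀ y (EuclideanSpace.single i 1) (EuclideanSpace.single j 1)))

/-- The Riemannian measure `√(det hᵢⱼ) dy¹ ⋯ dyⁿ` on the domain of the preferred chart around `x₀`,
extended by zero to `M`. -/
def chartArea [MeasurableSpace M] (h : BilinField n M) (x₀ : M) : Measure M :=
  Measure.map (extChartAt (𝓡 n) x₀).symm
    ((volume.restrict (extChartAt (𝓡 n) x₀).target).withDensity
      (fun y => ENNReal.ofReal (density h x₀ y)))

/-- The Riemannian measure `dA` of `h`. The measures on the chart domains agree on overlaps, so that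
their supremum in the lattice of measures is the measure on `M` that restricts to each of them. -/
def area [MeasurableSpace M] (h : BilinField n M) : Measure M :=
  ⨆ x₀ : M, chartArea h x₀

/-- The divergence of a 1-form `a` with respect to the metric `h`, i.e. the divergence of the dual
vector field, computed at `x` in the preferred chart around `x`:
`div a = (√det h)⁻¹ ∂ᵢ(√det h · hⁱʲ aⱼ)`. -/
def divergence (h : BilinField n M) (a : OneForm n M) (x : M) : ℝ :=
  let y₀ := extChartAt (𝓡 n) x x
  (density h x y₀)⁻¹ * ∑ i : Fin n,
    (fderiv ℝ (fun y => density h x y • (bilinCoord h x y).inverse (formCoord a x y)) y₀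
      (EuclideanSpace.single i 1)) i

end Charts

/-! ### Spacetimes -/

/-- A smooth Lorentzian metric, of signature `(-,+,+,+)`, on a 4-manifold. -/
structure LorentzMetric (N : Type*) [TopologicalSpace N] [ChartedSpace (Coord 4) N]
    [IsManifold (𝓡 4) ∞ N] where
  /-- The scalar product on each tangent space. -/
  val : BilinField 4 N
  symm : ∀ (x : N) (v w : TangentSpace (𝓡 4) x), val x v w = val x w v
  signature : ∀ x : N, ∃ e : Module.Basis (Fin 4) ℝ (TangentSpace (𝓡 4) x),
    ∀ i j, val x (e i) (e j) = if i = j then (if i = 0 then -1 else 1) else 0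
  smooth : ContMDiff (𝓡 4) ((𝓡 4).prod 𝓘(ℝ, Coord 4 →L[ℝ] Coord 4 →L[ℝ] ℝ)) ∞
    (fun x => TotalSpace.mk' (Coord 4 →L[ℝ] Coord 4 →L[ℝ] ℝ) x (val x))

section Spacetime

variable {N : Type*} [TopologicalSpace N] [ChartedSpace (Coord 4) N] [IsManifold (𝓡 4) ∞ N]

/-- A time orientation, given by a smooth timelike vector field: the future-timelike vectors are the
timelike ones in the same cone. -/
structure TimeOrientation (g : LorentzMetric N) where
  /-- The reference field. -/
  field : ∀ x : N, TangentSpace (𝓡 4) x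
  smooth : ContMDiff (𝓡 4) (𝓡 4).tangent ∞
    (fun x => (⟨x, field x⟩ : TangentBundle (𝓡 4) N))
  timelike : ∀ x, g.val x (field x) (field x) < 0

/-- `w` is future-timelike: it is timelike and in the same cone as the reference field. -/
def TimeOrientation.IsFuture {g : LorentzMetric N} (T : TimeOrientation g) (x : N)
    (w : TangentSpace (𝓡 4) x) : Prop :=
  g.val x w w < 0 ∧ g.val x w (T.field x) < 0

/-! ### Spacelike surfaces and their normal bundles -/

variable {S : Type*} [TopologicalSpace S] [ChartedSpace (Coord 2) S] [IsManifold (𝓡 2) ∞ S]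

/-- Vector fields of `N` along `Φ : S → N`. -/
abbrev FieldAlong (Φ : S → N) : Type _ := ∀ p : S, TangentSpace (𝓡 4) (Φ p)

/-- Smoothness of a vector field along `Φ`. -/
def FieldAlong.Smooth {Φ : S → N} (V : FieldAlong Φ) : Prop :=
  ContMDiff (𝓡 2) (𝓡 4).tangent ∞ (fun p => (⟨Φ p, V p⟩ : TangentBundle (𝓡 4) N))

/-- The differential of `Φ`. -/
def differential (Φ : S → N) (p : S) : TangentSpace (𝓡 2) p →L[ℝ] TangentSpace (𝓡 4) (Φ p) :=
  mfderiv (𝓡 2) (𝓡 4) Φ p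

/-- The metric induced on `S` by `Φ`. -/
def induced (g : LorentzMetric N) (Φ : S → N) : BilinField 2 S := fun p =>
  (ContinuousLinearMap.precomp ℝ (differential Φ p)) ∘L (g.val (Φ p)) ∘L (differential Φ p)

/-- `Φ` is a smooth embedding with spacelike image: the induced metric is Riemannian. -/
structure IsSpacelikeEmbedding (g : LorentzMetric N) (Φ : S → N) : Prop where
  embedding : Manifold.IsSmoothEmbedding (𝓡 2) (𝓡 4) ∞ Φ
  spacelike : ∀ (p : S) (X : TangentSpace (𝓡 2) p), X ≠ 0 → 0 < induced g Φ p X X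

/-- `w` is in the fiber at `p` of the normal bundle. -/
def IsNormal (g : LorentzMetric N) (Φ : S → N) (p : S) (w : TangentSpace (𝓡 4) (Φ p)) : Prop :=
  ∀ X : TangentSpace (𝓡 2) p, g.val (Φ p) w (differential Φ p X) = 0

/-- A choice of the outward side of the surface, given by a smooth spacelike normal field: the
spacelike vectors of each normal fiber, which has signature `(-,+)`, form two opposite quadrants, and
the outward ones are those in the quadrant of the reference field. -/
structure OutwardDirection (g : LorentzMetric N) (Φ : S → N) where
  /-- The reference field. -/
  field : FieldAlong Φ
  smooth : field.Smooth
  normal : ∀ p, IsNormal g Φ p (field p)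
  spacelike : ∀ p, 0 < g.val (Φ p) (field p) (field p)

/-- `w` is an outward-spacelike vector of the normal fiber at `p`: it is normal, spacelike, and in
the quadrant of the reference field. -/
def OutwardDirection.IsOutward {g : LorentzMetric N} {Φ : S → N} (O : OutwardDirection g Φ) (p : S)
    (w : TangentSpace (𝓡 4) (Φ p)) : Prop :=
  IsNormal g Φ p w ∧ 0 < g.val (Φ p) w w ∧ 0 < g.val (Φ p) w (O.field p)

/-- The orthogonal projection of `T_{Φ(p)}N` onto the normal fiber at `p`, i.e. the identity minus
the tangential part. -/
def normalProj (g : LorentzMetric N) (Φ : S → N) (p : S) :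
    TangentSpace (𝓡 4) (Φ p) →L[ℝ] TangentSpace (𝓡 4) (Φ p) :=
  ContinuousLinearMap.id ℝ _ - (differential Φ p) ∘L (induced g Φ p).inverse ∘L
    (ContinuousLinearMap.precomp ℝ (differential Φ p)) ∘L (g.val (Φ p))

/-- The Levi-Civita covariant derivative `X ↦ ∇_X V` at `p` of a vector field `V` along `Φ`. In the
preferred chart of `N` around `Φ(p)`,
`(∇_X V)ᵏ = X(Vᵏ) + Γᵏᵢⱼ dΦ(X)ⁱ Vʲ`. -/
def covDeriv (g : LorentzMetric N) (Φ : S → N) (V : FieldAlong Φ) (p : S) :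
    TangentSpace (𝓡 2) p →L[ℝ] TangentSpace (𝓡 4) (Φ p) :=
  let dV : TangentSpace (𝓡 2) p →L[ℝ] Coord 4 :=
    mfderiv (𝓡 2) 𝓘(ℝ, Coord 4) (fun q => comps (Φ p) (Φ q) (V q)) p
  (frame (Φ p) (Φ p)) ∘L
    (dV + (christoffel g.val (Φ p) (comps (Φ p) (Φ p) (V p))) ∘L
      (comps (Φ p) (Φ p)) ∘L (differential Φ p))

/-- The normal connection `X ↦ ∇^⊥_X V` at `p`. -/
def normalCovDeriv (g : LorentzMetric N) (Φ : S → N) (V : FieldAlong Φ) (p : S) :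
    TangentSpace (𝓡 2) p →L[ℝ] TangentSpace (𝓡 4) (Φ p) :=
  (normalProj g Φ p) ∘L (covDeriv g Φ V p)

/-- `(u, v)` is an orthonormal basis of the normal fiber at `p` with `u` future-timelike and `v`
outward-spacelike. -/
structure IsAdaptedFrame {g : LorentzMetric N} {Φ : S → N} (T : TimeOrientation g)
    (O : OutwardDirection g Φ) (p : S) (u v : TangentSpace (𝓡 4) (Φ p)) : Prop where
  normal : IsNormal g Φ p u
  future : T.IsFuture (Φ p) u
  outward : O.IsOutward p v
  unit_timelike : g.val (Φ p) u u = -1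
  unit_spacelike : g.val (Φ p) v v = 1
  orthogonal : g.val (Φ p) u v = 0

/-- The outward member of the adapted frame obtained by normalizing the reference fields. -/
def refOut {g : LorentzMetric N} {Φ : S → N} (O : OutwardDirection g Φ) (p : S) :
    TangentSpace (𝓡 4) (Φ p) :=
  (√ (g.val (Φ p) (O.field p) (O.field p)))⁻¹ • O.field p

/-- The component of the time-orienting field orthogonal to the surface and to `refOut`. -/
def refTimeAux {g : LorentzMetric N} {Φ : S → N} (T : TimeOrientation g)
    (O : OutwardDirection g Φ) (p : S) : TangentSpace (𝓡 4) (Φ p) :=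
  normalProj g Φ p (T.field (Φ p)) - (g.val (Φ p) (T.field (Φ p)) (refOut O p)) • refOut O p

/-- The future member of the adapted frame obtained by normalizing the reference fields. -/
def refTime {g : LorentzMetric N} {Φ : S → N} (T : TimeOrientation g)
    (O : OutwardDirection g Φ) (p : S) : TangentSpace (𝓡 4) (Φ p) :=
  (√ (-g.val (Φ p) (refTimeAux T O p) (refTimeAux T O p)))⁻¹ • refTimeAux T O p

/-- The involution `w ↦ w^⊥` of the normal fiber at `p`: for an orthonormal basis `(u, v)` of the
fiber with `u` future-timelike and `v` outward-spacelike, it is the linear map that exchanges `u` and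
`v`. It does not depend on the basis (see `perp_adapted`); the formula uses the basis
`(refTime, refOut)`. -/
def perp {g : LorentzMetric N} {Φ : S → N} (T : TimeOrientation g)
    (O : OutwardDirection g Φ) (p : S) (w : TangentSpace (𝓡 4) (Φ p)) :
    TangentSpace (𝓡 4) (Φ p) :=
  (g.val (Φ p) w (refOut O p)) • refTime T O p - (g.val (Φ p) w (refTime T O p)) • refOut O p

/-- `ν` is a (smooth) outward-spacelike section of unit length of the normal bundle. -/
structure IsUnitOutwardNormal {g : LorentzMetric N} {Φ : S → N} (O : OutwardDirection g Φ)
    (ν : FieldAlong Φ) : Prop where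
  smooth : ν.Smooth
  outward : ∀ p, O.IsOutward p (ν p)
  unit : ∀ p, g.val (Φ p) (ν p) (ν p) = 1

/-- The connection 1-form `α_ν(X) = ⟨∇^⊥_X ν, ν^⊥⟩`. -/
def connectionForm {g : LorentzMetric N} {Φ : S → N} (T : TimeOrientation g)
    (O : OutwardDirection g Φ) (ν : FieldAlong Φ) : OneForm 2 S := fun p =>
  (g.val (Φ p) (perp T O p (ν p))) ∘L (normalCovDeriv g Φ ν p)

/-- The functional `C(ν) = ∫_S |α_ν|² dA`. -/
def energy [MeasurableSpace S] {g : LorentzMetric N} {Φ : S → N} (T : TimeOrientation g)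
    (O : OutwardDirection g Φ) (ν : FieldAlong Φ) : ℝ :=
  ∫ p, normSq (induced g Φ) (connectionForm T O ν) p ∂(area (induced g Φ))

end Spacetime

/-! ### The involution `w ↦ w^⊥` does not depend on the adapted frame -/

/-- On a finite-dimensional space, an injective bilinear form has a genuine inverse. -/
lemma bilin_apply_inverse {E : Type*} [NormedAddCommGroup E] [NormedSpace ℝ E]
    [FiniteDimensional ℝ E] (B : E →L[ℝ] E →L[ℝ] ℝ) (hB : ∀ X, B X = 0 → X = 0)
    (l : E →L[ℝ] ℝ) : B (B.inverse l) = l := by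
  have hinj : Function.Injective B.toLinearMap :=
    (injective_iff_map_eq_zero B.toLinearMap).2 hB
  have hdim : Module.finrank ℝ E = Module.finrank ℝ (E →L[ℝ] ℝ) := by
    rw [(LinearMap.toContinuousLinearMap (𝕜 := ℝ) (E := E) (F' := ℝ)).symm.finrank_eq]
    exact (Subspace.dual_finrank_eq (K := ℝ) (V := E)).symm
  have e : ∃ e : E ≃L[ℝ] (E →L[ℝ] ℝ), (e : E →L[ℝ] E →L[ℝ] ℝ) = B := by
    refine ⟨(LinearEquiv.ofInjectiveOfFinrankEq B.toLinearMap hinj hdim).toContinuousLinearEquiv,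
      ?_⟩
    ext x y
    rfl
  exact ContinuousLinearMap.IsInvertible.self_apply_inverse e l

section PerpWellDefined

variable {N : Type*} [TopologicalSpace N] [ChartedSpace (Coord 4) N] [IsManifold (𝓡 4) ∞ N]
  {S : Type*} [TopologicalSpace S] [ChartedSpace (Coord 2) S]

lemma isNormal_normalProj {g : LorentzMetric N} {Φ : S → N} (hΦ : IsSpacelikeEmbedding g Φ)
    (p : S) (w : TangentSpace (𝓡 4) (Φ p)) : IsNormal g Φ p (normalProj g Φ p w) := by
  intro X
  have key : induced g Φ p ((induced g Φ p).inverse ((g.val (Φ p) w) ∘L (differential Φ p))) =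
      (g.val (Φ p) w) ∘L (differential Φ p) := by
    refine bilin_apply_inverse (E := Coord 2) (induced g Φ p) (fun X hX => ?_) _
    by_contra h
    have h1 := hΦ.spacelike p X h
    have h2 : induced g Φ p X X = 0 := congrArg (fun l => l X) hX
    exact absurd h1 (by rw [h2]; exact lt_irrefl _)
  have h3 : g.val (Φ p) (normalProj g Φ p w) = g.val (Φ p) w - g.val (Φ p) (differential Φ p
      ((induced g Φ p).inverse ((g.val (Φ p) w) ∘L (differential Φ p)))) := map_sub _ _ _
  have h4 : g.val (Φ p) (differential Φ p
      ((induced g Φ p).inverse ((g.val (Φ p) w) ∘L (differential Φ p)))) (differential Φ p X) =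
      g.val (Φ p) w (differential Φ p X) := congrArg (fun l => l X) key
  rw [h3]
  exact sub_eq_zero.2 h4.symm

lemma nondegenerate (g : LorentzMetric N) (x : N) (z : TangentSpace (𝓡 4) x)
    (hz : ∀ w, g.val x z w = 0) : z = 0 := by
  obtain ⟨e, he⟩ := g.signature x
  rw [← e.sum_repr z] at hz ⊢
  refine Finset.sum_eq_zero fun i _ => ?_
  have h := hz (e i)
  have h2 : g.val x (∑ j, e.repr z j • e j) (e i) = ∑ j, e.repr z j * g.val x (e j) (e i) := by
    rw [map_sum]
    simp
  rw [h2] at h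
  have h3 : e.repr z i = 0 := by
    simp only [he] at h
    simp only [mul_ite, mul_zero, Finset.sum_ite_eq', Finset.mem_univ,
      if_true] at h
    split_ifs at h <;> linarith
  rw [h3]
  exact zero_smul ℝ (e i)

/-- An adapted frame spans the normal fiber. -/
lemma IsAdaptedFrame.expand {g : LorentzMetric N} {Φ : S → N} (hΦ : IsSpacelikeEmbedding g Φ)
    {T : TimeOrientation g} {O : OutwardDirection g Φ} {p : S}
    {u v : TangentSpace (𝓡 4) (Φ p)} (h : IsAdaptedFrame T O p u v)
    {w : TangentSpace (𝓡 4) (Φ p)} (hw : IsNormal g Φ p w) :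
    w = (g.val (Φ p) w v) • v - (g.val (Φ p) w u) • u := by
  have huu := h.unit_timelike
  have hvv := h.unit_spacelike
  have huv := h.orthogonal
  have hvu : g.val (Φ p) v u = 0 := by rw [g.symm]; exact huv
  let L : (TangentSpace (𝓡 2) p × (ℝ × ℝ)) →ₗ[ℝ] TangentSpace (𝓡 4) (Φ p) :=
    LinearMap.coprod (differential Φ p).toLinearMap
      (LinearMap.coprod (LinearMap.toSpanSingleton ℝ _ u) (LinearMap.toSpanSingleton ℝ _ v))
  have hL : ∀ X a b, L (X, (a, b)) = differential Φ p X + (a • u + b • v) := fun X a b => rfl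
  have hinj : Function.Injective L := by
    refine (injective_iff_map_eq_zero L).2 ?_
    rintro ⟨X, a, b⟩ h0
    rw [hL] at h0
    have h1 : g.val (Φ p) u (differential Φ p X + (a • u + b • v)) = 0 := by rw [h0, map_zero]
    have h2 : g.val (Φ p) v (differential Φ p X + (a • u + b • v)) = 0 := by rw [h0, map_zero]
    simp only [map_add, map_smul, smul_eq_mul, h.normal X, h.outward.1 X, huu, hvv, huv, hvu]
      at h1 h2
    have ha : a = 0 := by linarith
    have hb : b = 0 := by linarith
    subst ha hb
    have hX : X = 0 := by
      by_contra hne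
      have h3 := hΦ.spacelike p X hne
      have h4 : differential Φ p X = 0 := by simpa using h0
      have h5 : induced g Φ p X X = g.val (Φ p) (differential Φ p X) (differential Φ p X) := rfl
      rw [h5, h4, map_zero] at h3
      exact lt_irrefl _ h3
    rw [hX]
    rfl
  have hdim : Module.finrank ℝ (TangentSpace (𝓡 2) p × (ℝ × ℝ)) =
      Module.finrank ℝ (TangentSpace (𝓡 4) (Φ p)) := by
    have h2 : Module.finrank ℝ (TangentSpace (𝓡 2) p) = 2 := finrank_euclideanSpace_fin
    have h4 : Module.finrank ℝ (TangentSpace (𝓡 4) (Φ p)) = 4 := finrank_euclideanSpace_fin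
    have : FiniteDimensional ℝ (TangentSpace (𝓡 2) p) :=
      inferInstanceAs (FiniteDimensional ℝ (Coord 2))
    rw [Module.finrank_prod, Module.finrank_prod, h2, h4]
    simp
  have hsurj : Function.Surjective L := by
    have : FiniteDimensional ℝ (TangentSpace (𝓡 2) p) :=
      inferInstanceAs (FiniteDimensional ℝ (Coord 2))
    have : FiniteDimensional ℝ (TangentSpace (𝓡 4) (Φ p)) :=
      inferInstanceAs (FiniteDimensional ℝ (Coord 4))
    exact (LinearMap.injective_iff_surjective_of_finrank_eq_finrank hdim).1 hinj
  have hz : w - ((g.val (Φ p) w v) • v - (g.val (Φ p) w u) • u) = 0 := by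
    refine nondegenerate g (Φ p) _ fun y => ?_
    obtain ⟨⟨X, a, b⟩, rfl⟩ := hsurj y
    rw [hL, map_sub, map_sub, map_smul, map_smul]
    simp only [sub_apply, smul_apply, map_add, map_smul,
      smul_eq_mul, h.normal X, h.outward.1 X, hw X, huu, hvv, huv, hvu]
    ring
  exact sub_eq_zero.1 hz

/-- The involution exchanges the two members of every adapted frame. -/
theorem perp_adapted {g : LorentzMetric N} {Φ : S → N} (hΦ : IsSpacelikeEmbedding g Φ)
    {T : TimeOrientation g} {O : OutwardDirection g Φ} {p : S}
    {u v : TangentSpace (𝓡 4) (Φ p)} (h : IsAdaptedFrame T O p u v) :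
    perp T O p u = v ∧ perp T O p v = u := by
  have huu := h.unit_timelike
  have hvv := h.unit_spacelike
  have huv := h.orthogonal
  have hvu : g.val (Φ p) v u = 0 := by rw [g.symm]; exact huv
  -- scalar products of normal vectors in the frame
  have gram : ∀ a b c d : ℝ, g.val (Φ p) (a • u + b • v) (c • u + d • v) = b * d - a * c := by
    intro a b c d
    rw [map_add, map_smul, map_smul]
    simp only [add_apply, smul_apply, map_add, map_smul,
      smul_eq_mul, huu, hvv, huv, hvu]
    ring
  have span : ∀ w, IsNormal g Φ p w → ∃ a b : ℝ, w = a • u + b • v ∧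
      a = -g.val (Φ p) w u ∧ b = g.val (Φ p) w v := fun w hw =>
    ⟨-g.val (Φ p) w u, g.val (Φ p) w v, by
      conv_lhs => rw [h.expand hΦ hw]
      module, rfl, rfl⟩
  -- the outward member of the reference frame
  obtain ⟨a, b, hη, -, hb⟩ := span _ (O.normal p)
  have hb0 : 0 < b := by rw [hb, g.symm]; exact h.outward.2.2
  have hη2 : 0 < b * b - a * a := by
    have := O.spacelike p
    rwa [hη, gram] at this
  set r : ℝ := √ (b * b - a * a) with hr
  have hr0 : 0 < r := Real.sqrt_pos.2 hη2
  have hr2 : r * r = b * b - a * a := Real.mul_self_sqrt hη2.le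
  have hv0 : refOut O p = (r⁻¹ * a) • u + (r⁻¹ * b) • v := by
    rw [refOut, hη, gram, ← hr]
    module
  obtain ⟨s, hs⟩ : ∃ s, s = r⁻¹ * a := ⟨_, rfl⟩
  obtain ⟨c, hc⟩ : ∃ c, c = r⁻¹ * b := ⟨_, rfl⟩
  rw [← hs, ← hc] at hv0
  have hcpos : 0 < c := by rw [hc]; positivity
  have hcs : c * c - s * s = 1 := by
    have : c * c - s * s = r⁻¹ * r⁻¹ * (r * r) := by rw [hr2, hs, hc]; ring
    rw [this]
    field_simp
  -- the future member
  obtain ⟨x, y, ht, -, -⟩ := span _ (isNormal_normalProj hΦ p (T.field (Φ p)))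
  obtain ⟨X, hX⟩ : ∃ X, T.field (Φ p) = normalProj g Φ p (T.field (Φ p)) + differential Φ p X :=
    ⟨(induced g Φ p).inverse ((g.val (Φ p) (T.field (Φ p))) ∘L (differential Φ p)),
      (sub_add_cancel _ _).symm⟩
  rw [ht] at hX
  have hTn : ∀ α β : ℝ, g.val (Φ p) (T.field (Φ p)) (α • u + β • v) = y * β - x * α := by
    intro α β
    rw [hX, map_add (g.val (Φ p)) (x • u + y • v), add_apply, gram, g.symm (Φ p) (differential Φ p X)]
    rw [map_add, map_smul, map_smul]
    simp only [add_apply, smul_apply, h.normal X,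
      h.outward.1 X]
    simp
  have hx : 0 < x := by
    have h1 := h.future.2
    have h2 := hTn 1 0
    rw [g.symm] at h1
    simp only [one_smul, zero_smul, add_zero] at h2
    linarith
  have hxy : y * y < x * x := by
    have h1 := T.timelike (Φ p)
    have h2 : g.val (Φ p) (T.field (Φ p)) (T.field (Φ p)) =
        y * y - x * x + g.val (Φ p) (differential Φ p X) (differential Φ p X) := by
      have h3 := hTn x y
      have h4 : g.val (Φ p) (T.field (Φ p)) (differential Φ p X) =
          g.val (Φ p) (differential Φ p X) (differential Φ p X) := by
        conv_lhs => rw [hX]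
        rw [map_add, map_add, map_smul, map_smul]
        simp only [add_apply, smul_apply, h.normal X,
          h.outward.1 X]
        simp
      rw [← h3, ← h4, ← map_add, ← hX]
    have h5 : 0 ≤ g.val (Φ p) (differential Φ p X) (differential Φ p X) := by
      by_cases h0 : X = 0
      · rw [h0]; simp
      · exact (hΦ.spacelike p X h0).le
    linarith
  have hk : 0 < c * x - s * y := by
    have h1 : (s * y) ^ 2 < (c * x) ^ 2 := by
      nlinarith [mul_pos hx hx, mul_self_nonneg s, mul_self_nonneg y, mul_self_nonneg c]
    have h2 := abs_lt_of_sq_lt_sq h1 (by positivity)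
    linarith [(abs_lt.1 h2).2, le_abs_self (s * y)]
  obtain ⟨k, hkk⟩ : ∃ k, k = c * x - s * y := ⟨_, rfl⟩
  rw [← hkk] at hk
  have hτ : refTimeAux T O p = (k * c) • u + (k * s) • v := by
    have h1 : refTimeAux T O p = (x - (y * c - x * s) * s) • u + (y - (y * c - x * s) * c) • v := by
      rw [refTimeAux, hv0, hTn, ht]
      module
    have e1 : x - (y * c - x * s) * s = k * c := by
      rw [hkk]; linear_combination (-x) * hcs
    have e2 : y - (y * c - x * s) * c = k * s := by
      rw [hkk]; linear_combination (-y) * hcs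
    rw [h1, e1, e2]
  have hu0 : refTime T O p = c • u + s • v := by
    have h1 : -(k * s * (k * s) - k * c * (k * c)) = k * k := by
      linear_combination (k * k) * hcs
    rw [refTime, hτ, gram, h1, Real.sqrt_mul_self hk.le, smul_add, smul_smul, smul_smul,
      inv_mul_cancel_left₀ hk.ne', inv_mul_cancel_left₀ hk.ne']
  have hu1 : ∀ α β : ℝ, g.val (Φ p) u (α • u + β • v) = -α := by
    intro α β
    have := gram 1 0 α β
    simp only [one_smul, zero_smul, add_zero] at this
    linarith
  have hv1 : ∀ α β : ℝ, g.val (Φ p) v (α • u + β • v) = β := by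
    intro α β
    have := gram 0 1 α β
    simp only [one_smul, zero_smul, zero_add] at this
    linarith
  constructor
  · rw [perp, hu0, hv0, hu1, hu1]
    have e : (-s) • (c • u + s • v) - (-c) • (s • u + c • v) = (c * c - s * s) • v := by module
    rw [e, hcs, one_smul]
  · rw [perp, hu0, hv0, hv1, hv1]
    have e : c • (c • u + s • v) - s • (s • u + c • v) = (c * c - s * s) • u := by module
    rw [e, hcs, one_smul]

end PerpWellDefined

end StraightOut

end

/-!
In the orthonormal frame `(u, v)` of the normal bundle obtained from the reference fields, the unit
outward normals are the sections `cosh θ • v + sinh θ • u` with `θ` a smooth function. Metric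
compatibility of the Levi-Civita connection shows that replacing `θ` by `θ + f` replaces the
connection form `α` by `α - df`. By the divergence theorem
`∫ |α - t df|² = ∫ |α|² + 2 t ∫ f div α + t² ∫ |df|²`, which is minimal at `t = 0` for every `f`
if and only if `div α = 0`.

The divergence theorem is proved with functions supported in a single chart, and the independence of
the divergence from the chart follows by testing against them. The connection form is smooth because
of the transformation law of the Christoffel symbols.
-/

noncomputable section

namespace StraightOut

open Filter Topology

/-! ### Charts -/

section Charts

variable {n m : ℕ} {M : Type*} [TopologicalSpace M] [ChartedSpace (Coord n) M]
  {M' : Type*} [TopologicalSpace M'] [ChartedSpace (Coord m) M']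
  {F : Type*} [NormedAddCommGroup F] [NormedSpace ℝ F]

/-- A map between manifolds read in the preferred charts around `x₀` and `z₀`. Unlike in
`writtenInExtChartAt`, the two base points are unrelated. -/
def mapCoord (f : M → M') (x₀ : M) (z₀ : M') (y : Coord n) : Coord m :=
  extChartAt (𝓡 m) z₀ (f ((extChartAt (𝓡 n) x₀).symm y))

/-- The domain of `mapCoord f x₀ z₀`: the part of the chart domain around `x₀` that `f` sends to the
chart domain around `z₀`, in coordinates. -/
def mapDomain (f : M → M') (x₀ : M) (z₀ : M') : Set (Coord n) :=
  (extChartAt (𝓡 n) x₀).target ∩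
    (extChartAt (𝓡 n) x₀).symm ⁻¹' (f ⁻¹' (extChartAt (𝓡 m) z₀).source)

lemma isOpen_mapDomain {f : M → M'} (hf : Continuous f) (x₀ : M) (z₀ : M') :
    IsOpen (mapDomain (n := n) (m := m) f x₀ z₀) :=
  (continuousOn_extChartAt_symm x₀).isOpen_inter_preimage (isOpen_extChartAt_target x₀)
    ((isOpen_extChartAt_source z₀).preimage hf)

lemma mem_mapDomain_self (f : M → M') {x₀ : M} {y : Coord n}
    (hy : y ∈ (extChartAt (𝓡 n) x₀).target) :
    y ∈ mapDomain (n := n) (m := m) f x₀ (f ((extChartAt (𝓡 n) x₀).symm y)) :=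
  ⟨hy, mem_extChartAt_source _⟩

lemma extChartAt_mem_mapDomain {f : M → M'} {x₀ q : M} {z₀ : M'}
    (hq : q ∈ (extChartAt (𝓡 n) x₀).source) (hfq : f q ∈ (extChartAt (𝓡 m) z₀).source) :
    extChartAt (𝓡 n) x₀ q ∈ mapDomain (n := n) (m := m) f x₀ z₀ := by
  refine ⟨(extChartAt (𝓡 n) x₀).map_source hq, ?_⟩
  rwa [mem_preimage, (extChartAt (𝓡 n) x₀).left_inv hq]

lemma contDiffOn_target_of_mapDomain {k : WithTop ℕ∞} {f : M → M'} (hf : Continuous f)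
    {u : Coord n → F} {x₀ : M}
    (h : ∀ z₀ : M', ContDiffOn ℝ k u (mapDomain (n := n) (m := m) f x₀ z₀)) :
    ContDiffOn ℝ k u (extChartAt (𝓡 n) x₀).target := fun _ hy =>
  ((h _).contDiffAt ((isOpen_mapDomain hf x₀ _).mem_nhds
    (mem_mapDomain_self f hy))).contDiffWithinAt

/-- The coordinates around `x₁` as functions of the coordinates around `x₀`. -/
abbrev transition (x₀ x₁ : M) : Coord n → Coord n := mapCoord (n := n) (m := n) id x₀ x₁

/-- The overlap of the charts around `x₀` and `x₁`, in the coordinates around `x₀`. -/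
abbrev overlap (x₀ x₁ : M) : Set (Coord n) := mapDomain (n := n) (m := n) id x₀ x₁

lemma symm_transition {x₀ x₁ : M} {y : Coord n} (hy : y ∈ overlap x₀ x₁) :
    (extChartAt (𝓡 n) x₁).symm (transition x₀ x₁ y) = (extChartAt (𝓡 n) x₀).symm y :=
  (extChartAt (𝓡 n) x₁).left_inv hy.2

lemma transition_mem_target {x₀ x₁ : M} {y : Coord n} (hy : y ∈ overlap x₀ x₁) :
    transition x₀ x₁ y ∈ (extChartAt (𝓡 n) x₁).target :=
  (extChartAt (𝓡 n) x₁).map_source hy.2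

lemma injOn_transition (x₀ x₁ : M) : InjOn (transition (n := n) x₀ x₁) (overlap x₀ x₁) := by
  intro y hy z hz hyz
  have h := symm_transition hy
  rw [hyz, symm_transition hz] at h
  exact ((extChartAt (𝓡 n) x₀).symm.injOn hz.1 hy.1 h).symm

lemma transition_image_preimage {x₀ x₁ : M} {B : Set M} (hB₀ : B ⊆ (extChartAt (𝓡 n) x₀).source)
    (hB₁ : B ⊆ (extChartAt (𝓡 n) x₁).source) :
    transition x₀ x₁ '' ((extChartAt (𝓡 n) x₀).target ∩ (extChartAt (𝓡 n) x₀).symm ⁻¹' B) =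
      (extChartAt (𝓡 n) x₁).target ∩ (extChartAt (𝓡 n) x₁).symm ⁻¹' B := by
  rw [← (extChartAt (𝓡 n) x₀).image_eq_target_inter_inv_preimage hB₀,
    ← (extChartAt (𝓡 n) x₁).image_eq_target_inter_inv_preimage hB₁, image_image]
  exact image_congr fun q hq => congrArg _ ((extChartAt (𝓡 n) x₀).left_inv (hB₀ hq))

lemma contMDiffAt_of_comp_extChartAt_symm {k : ℕ∞} {f : M → F} {x : M}
    (hf : ContDiffAt ℝ k (fun y => f ((extChartAt (𝓡 n) x).symm y)) (extChartAt (𝓡 n) x x)) :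
    ContMDiffAt (𝓡 n) 𝓘(ℝ, F) k f x := by
  have hchart : ContMDiffAt (𝓡 n) 𝓘(ℝ, Coord n) k (extChartAt (𝓡 n) x) x :=
    (contMDiffAt_extChartAt (n := ∞)).of_le (by exact_mod_cast le_top)
  refine (hf.contMDiffAt.comp x hchart).congr_of_eventuallyEq ?_
  filter_upwards [extChartAt_source_mem_nhds (I := 𝓡 n) x] with q hq
  exact congrArg f ((extChartAt (𝓡 n) x).left_inv hq).symm

variable [IsManifold (𝓡 n) ∞ M]

lemma comps_frame {x₀ x : M} (hx : x ∈ (extChartAt (𝓡 n) x₀).source) (c : Coord n) :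
    comps (n := n) x₀ x (frame x₀ x c) = c := by
  rw [extChartAt_source] at hx
  exact (trivializationAt (Coord n) (TangentSpace (𝓡 n)) x₀).continuousLinearMapAt_symmL
    (by simpa using hx) c

lemma frame_comps {x₀ x : M} (hx : x ∈ (extChartAt (𝓡 n) x₀).source)
    (v : TangentSpace (𝓡 n) x) : frame x₀ x (comps (n := n) x₀ x v) = v := by
  rw [extChartAt_source] at hx
  exact (trivializationAt (Coord n) (TangentSpace (𝓡 n)) x₀).symmL_continuousLinearMapAt
    (by simpa using hx) v

lemma hasMFDerivAt_extChartAt {x₀ x : M} (hx : x ∈ (extChartAt (𝓡 n) x₀).source) :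
    HasMFDerivAt (𝓡 n) 𝓘(ℝ, Coord n) (extChartAt (𝓡 n) x₀) x (comps x₀ x) := by
  rw [extChartAt_source] at hx
  have h := (mdifferentiableAt_extChartAt (I := 𝓡 n) hx).hasMFDerivAt
  rwa [← TangentBundle.continuousLinearMapAt_trivializationAt hx] at h

lemma hasMFDerivAt_extChartAt_symm {x₀ : M} {y : Coord n}
    (hy : y ∈ (extChartAt (𝓡 n) x₀).target) :
    HasMFDerivAt 𝓘(ℝ, Coord n) (𝓡 n) (extChartAt (𝓡 n) x₀).symm y
      (frame x₀ ((extChartAt (𝓡 n) x₀).symm y)) := by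
  have hs := (extChartAt (𝓡 n) x₀).map_target hy
  rw [extChartAt_source] at hs
  have hframe := TangentBundle.symmL_trivializationAt (I := 𝓡 n) (𝕜 := ℝ) hs
  have h := (mdifferentiableWithinAt_extChartAt_symm (I := 𝓡 n) hy).hasMFDerivWithinAt
  rw [(extChartAt (𝓡 n) x₀).right_inv hy] at hframe
  rw [← hframe, ModelWithCorners.range_eq_univ] at h
  exact hasMFDerivWithinAt_univ.1 h

lemma hasFDerivAt_comp_extChartAt_symm {f : M → F} {x₀ : M} {y : Coord n}
    (hy : y ∈ (extChartAt (𝓡 n) x₀).target)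
    (hf : MDifferentiableAt (𝓡 n) 𝓘(ℝ, F) f ((extChartAt (𝓡 n) x₀).symm y)) :
    HasFDerivAt (fun y => f ((extChartAt (𝓡 n) x₀).symm y))
      ((mfderiv (𝓡 n) 𝓘(ℝ, F) f ((extChartAt (𝓡 n) x₀).symm y)) ∘L
        (frame x₀ ((extChartAt (𝓡 n) x₀).symm y))) y :=
  (hf.hasMFDerivAt.comp y (hasMFDerivAt_extChartAt_symm hy)).hasFDerivAt

lemma contDiffOn_comp_extChartAt_symm {k : ℕ∞} {f : M → F}
    (hf : ContMDiff (𝓡 n) 𝓘(ℝ, F) k f) (x₀ : M) :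
    ContDiffOn ℝ k (fun y => f ((extChartAt (𝓡 n) x₀).symm y)) (extChartAt (𝓡 n) x₀).target := by
  rw [← contMDiffOn_iff_contDiffOn]
  exact hf.comp_contMDiffOn ((contMDiffOn_extChartAt_symm (n := ∞) x₀).of_le
    (by exact_mod_cast le_top))

lemma hasFDerivAt_transition {x₀ x₁ : M} {y : Coord n} (hy : y ∈ overlap x₀ x₁) :
    HasFDerivAt (transition x₀ x₁)
      ((comps (n := n) x₁ ((extChartAt (𝓡 n) x₀).symm y)) ∘L
        (frame x₀ ((extChartAt (𝓡 n) x₀).symm y))) y :=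
  ((hasMFDerivAt_extChartAt hy.2).comp y (hasMFDerivAt_extChartAt_symm hy.1)).hasFDerivAt

lemma frame_eq_frame_fderiv_transition {x₀ x₁ : M} {y : Coord n} (hy : y ∈ overlap x₀ x₁)
    (c : Coord n) :
    frame x₀ ((extChartAt (𝓡 n) x₀).symm y) c =
      frame x₁ ((extChartAt (𝓡 n) x₀).symm y) (fderiv ℝ (transition x₀ x₁) y c) := by
  rw [(hasFDerivAt_transition hy).fderiv]
  exact (frame_comps hy.2 _).symm

variable [IsManifold (𝓡 m) ∞ M']

lemma hasFDerivAt_mapCoord {f : M → M'} {x₀ : M} {z₀ : M'} {y : Coord n}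
    (hy : y ∈ mapDomain (n := n) (m := m) f x₀ z₀)
    (hf : MDifferentiableAt (𝓡 n) (𝓡 m) f ((extChartAt (𝓡 n) x₀).symm y)) :
    HasFDerivAt (mapCoord (n := n) (m := m) f x₀ z₀)
      ((comps z₀ (f ((extChartAt (𝓡 n) x₀).symm y))) ∘L
        (mfderiv (𝓡 n) (𝓡 m) f ((extChartAt (𝓡 n) x₀).symm y)) ∘L
        (frame x₀ ((extChartAt (𝓡 n) x₀).symm y))) y :=
  ((hasMFDerivAt_extChartAt hy.2).comp y
    (hf.hasMFDerivAt.comp y (hasMFDerivAt_extChartAt_symm hy.1))).hasFDerivAt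

lemma contDiffOn_mapCoord {k : ℕ∞} {f : M → M'}
    (hf : ContMDiff (𝓡 n) (𝓡 m) k f) (x₀ : M) (z₀ : M') :
    ContDiffOn ℝ k (mapCoord (n := n) (m := m) f x₀ z₀)
      (mapDomain (n := n) (m := m) f x₀ z₀) := by
  have hk : (k : WithTop ℕ∞) ≤ ∞ := by exact_mod_cast le_top
  have hchart : ContMDiffOn (𝓡 m) 𝓘(ℝ, Coord m) k (extChartAt (𝓡 m) z₀)
      (extChartAt (𝓡 m) z₀).source := by
    rw [extChartAt_source]
    exact (contMDiffOn_extChartAt (n := ∞)).of_le hk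
  have hf' := hf.comp_contMDiffOn ((contMDiffOn_extChartAt_symm (n := ∞) x₀).of_le hk)
  rw [← contMDiffOn_iff_contDiffOn]
  exact hchart.comp (hf'.mono inter_subset_left) fun y hy => hy.2

end Charts

/-! ### Bilinear forms -/

section BilinearForms

variable {E F : Type*} [NormedAddCommGroup E] [NormedSpace ℝ E] [NormedAddCommGroup F]
  [NormedSpace ℝ F] {n : ℕ}

/-- The pullback `B(P ·, P ·)` of a bilinear form. -/
def pullbackForm (B : F →L[ℝ] F →L[ℝ] ℝ) (P : E →L[ℝ] F) : E →L[ℝ] E →L[ℝ] ℝ :=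
  (ContinuousLinearMap.precomp ℝ P) ∘L B ∘L P

@[simp] lemma pullbackForm_apply (B : F →L[ℝ] F →L[ℝ] ℝ) (P : E →L[ℝ] F) (c d : E) :
    pullbackForm B P c d = B (P c) (P d) := rfl

/-- The determinant of the Gram matrix of a bilinear form on `ℝⁿ`. -/
def gramDet (B : Coord n →L[ℝ] Coord n →L[ℝ] ℝ) : ℝ :=
  Matrix.det (Matrix.of fun i j : Fin n =>
    B (EuclideanSpace.single i 1) (EuclideanSpace.single j 1))

lemma gramDet_pullbackForm (B : Coord n →L[ℝ] Coord n →L[ℝ] ℝ) (P : Coord n →L[ℝ] Coord n) :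
    gramDet (pullbackForm B P) = P.det ^ 2 * gramDet B := by
  let b := (EuclideanSpace.basisFun (Fin n) ℝ).toBasis
  let toBil (B : Coord n →L[ℝ] Coord n →L[ℝ] ℝ) : LinearMap.BilinForm ℝ (Coord n) :=
    LinearMap.mk₂ ℝ (fun c d => B c d) (by simp) (by simp) (by simp) (by simp)
  have hgram (B) : gramDet B = (LinearMap.BilinForm.toMatrix b (toBil B)).det := by
    rw [gramDet]
    congr 1
  have hpull : toBil (pullbackForm B P) = (toBil B).comp P.toLinearMap P.toLinearMap := by
    ext
    rfl
  rw [hgram, hgram, hpull, LinearMap.BilinForm.toMatrix_comp b b, Matrix.det_mul, Matrix.det_mul,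
    Matrix.det_transpose, LinearMap.det_toMatrix, ContinuousLinearMap.det]
  ring

lemma gramDet_pos {B : Coord n →L[ℝ] Coord n →L[ℝ] ℝ} (hsymm : ∀ c d, B c d = B d c)
    (hpos : ∀ c, c ≠ 0 → 0 < B c c) : 0 < gramDet B := by
  refine Matrix.PosDef.det_pos (Matrix.PosDef.of_dotProduct_mulVec_pos ?_ fun x hx => ?_)
  · ext i j
    simp [hsymm]
  · have hx' : WithLp.toLp 2 x ≠ (0 : Coord n) := fun h => hx (by simpa using h)
    have hsum : (WithLp.toLp 2 x : Coord n) = ∑ i, x i • EuclideanSpace.single i (1 : ℝ) := by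
      ext j
      simp [Pi.single_apply]
    have h := hpos _ hx'
    rw [hsum] at h
    simp only [map_sum, map_smul, sum_apply, smul_apply, smul_eq_mul, Finset.mul_sum] at h
    rw [Finset.sum_comm] at h
    simpa [dotProduct, Matrix.mulVec, Finset.mul_sum, mul_comm, mul_left_comm] using h

lemma contDiff_gramDet {k : WithTop ℕ∞} :
    ContDiff ℝ k (gramDet : (Coord n →L[ℝ] Coord n →L[ℝ] ℝ) → ℝ) := by
  unfold gramDet
  simp only [Matrix.det_apply, Matrix.of_apply]
  fun_prop

lemma eq_zero_of_apply_eq_zero {B : E →L[ℝ] E →L[ℝ] ℝ} (hB : ∀ v, v ≠ 0 → 0 < B v v) {v : E}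
    (hv : B v = 0) : v = 0 := by
  by_contra hne
  have h := hB v hne
  rw [hv] at h
  exact lt_irrefl _ h

variable [FiniteDimensional ℝ E]

lemma isInvertible_of_pos {B : E →L[ℝ] E →L[ℝ] ℝ} (hB : ∀ v, v ≠ 0 → 0 < B v v) :
    B.IsInvertible := by
  have hker (v) : B v = 0 → v = 0 := eq_zero_of_apply_eq_zero hB
  have : CompleteSpace E := FiniteDimensional.complete ℝ E
  exact ⟨.ofBijective B (LinearMap.ker_eq_bot'.2 hker)
    (LinearMap.range_eq_top.2 fun l => ⟨_, bilin_apply_inverse B hker l⟩), rfl⟩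

lemma contDiffAt_inverse_of_pos {B : E →L[ℝ] E →L[ℝ] ℝ} (hB : ∀ v, v ≠ 0 → 0 < B v v)
    {k : WithTop ℕ∞} :
    ContDiffAt ℝ k (ContinuousLinearMap.inverse : (E →L[ℝ] E →L[ℝ] ℝ) → _) B := by
  obtain ⟨e, rfl⟩ := isInvertible_of_pos hB
  have : CompleteSpace E := FiniteDimensional.complete ℝ E
  exact contDiffAt_map_inverse e

end BilinearForms

/-! ### Riemannian metrics and their measures -/

section RiemannianMetrics

lemma iSup_measure_apply_of_agree {X ι : Type*} [MeasurableSpace X] {κ : ι → Measure X}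
    {U : ι → Set X} (hU : ∀ i, MeasurableSet (U i)) (hnull : ∀ i, κ i (U i)ᶜ = 0)
    (hagree : ∀ i j B, MeasurableSet B → B ⊆ U i → B ⊆ U j → κ i B = κ j B)
    {i : ι} {B : Set X} (hB : MeasurableSet B) (hBU : B ⊆ U i) : (⨆ j, κ j) B = κ i B := by
  refine le_antisymm ?_ (le_iSup κ i B)
  have hinter (j) : (κ j).restrict (U i) ≤ κ i := Measure.le_iff.2 fun C hC => by
    have hC' : MeasurableSet (C ∩ U i) := hC.inter (hU i)
    rw [Measure.restrict_apply hC, ← measure_inter_add_sdiff (C ∩ U i) (hU j),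
      measure_mono_null (s := (C ∩ U i) \ U j) (fun _ hx => hx.2) (hnull j), add_zero,
      hagree j i _ (hC'.inter (hU j)) inter_subset_right
        (inter_subset_left.trans inter_subset_right)]
    exact measure_mono (inter_subset_left.trans inter_subset_left)
  -- The summand `⊤` imposes no condition off `U i` and does not contribute to the measure of `B`.
  have hle : ⨆ j, κ j ≤ κ i + (⊤ : Measure X).restrict (U i)ᶜ := iSup_le fun j => by
    conv_lhs => rw [← Measure.restrict_add_restrict_compl (μ := κ j) (hU i)]
    exact add_le_add (hinter j) (Measure.restrict_mono subset_rfl le_top)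
  calc (⨆ j, κ j) B ≤ κ i B + (⊤ : Measure X).restrict (U i)ᶜ B := hle B
    _ = κ i B := by
      rw [Measure.restrict_apply hB, (disjoint_compl_right_iff_subset.2 hBU).inter_eq,
        measure_empty, add_zero]

variable {n : ℕ} {M : Type*} [TopologicalSpace M] [ChartedSpace (Coord n) M]

lemma measurableSet_target_inter_preimage [MeasurableSpace M] [BorelSpace M]
    (x₀ : M) {B : Set M} (hB : MeasurableSet B) :
    MeasurableSet ((extChartAt (𝓡 n) x₀).target ∩ (extChartAt (𝓡 n) x₀).symm ⁻¹' B) := by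
  rw [← Subtype.image_preimage_coe]
  exact (MeasurableEmbedding.subtype_coe
    (isOpen_extChartAt_target (I := 𝓡 n) x₀).measurableSet).measurableSet_image.2
    ((continuousOn_extChartAt_symm (I := 𝓡 n) x₀).domRestrict.measurable hB)

variable [IsManifold (𝓡 n) ∞ M]

lemma bilinCoord_apply (h : BilinField n M) (x₀ : M) (y c d : Coord n) :
    bilinCoord h x₀ y c d = h ((extChartAt (𝓡 n) x₀).symm y)
      (frame x₀ ((extChartAt (𝓡 n) x₀).symm y) c)
      (frame x₀ ((extChartAt (𝓡 n) x₀).symm y) d) := rfl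

lemma density_eq_sqrt_gramDet (h : BilinField n M) (x₀ : M) (y : Coord n) :
    density h x₀ y = √ (gramDet (bilinCoord h x₀ y)) := rfl

lemma bilinCoord_eq_pullbackForm (h : BilinField n M) {x₀ x₁ : M} {y : Coord n}
    (hy : y ∈ overlap x₀ x₁) :
    bilinCoord h x₀ y =
      pullbackForm (bilinCoord h x₁ (transition x₀ x₁ y)) (fderiv ℝ (transition x₀ x₁) y) := by
  ext c d
  rw [pullbackForm_apply, bilinCoord_apply, bilinCoord_apply, symm_transition hy,
    frame_eq_frame_fderiv_transition hy, frame_eq_frame_fderiv_transition hy d]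

lemma density_eq_abs_det_mul (h : BilinField n M) {x₀ x₁ : M} {y : Coord n}
    (hy : y ∈ overlap x₀ x₁) :
    density h x₀ y =
      |(fderiv ℝ (transition x₀ x₁) y).det| * density h x₁ (transition x₀ x₁ y) := by
  rw [density_eq_sqrt_gramDet, density_eq_sqrt_gramDet, bilinCoord_eq_pullbackForm h hy,
    gramDet_pullbackForm, Real.sqrt_mul (sq_nonneg _), Real.sqrt_sq_eq_abs]

/-- A Riemannian metric with continuously differentiable components in every preferred chart. -/
structure IsRiemannian (h : BilinField n M) : Prop where
  symm : ∀ (x : M) (v w : TangentSpace (𝓡 n) x), h x v w = h x w v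
  pos : ∀ (x : M) (v : TangentSpace (𝓡 n) x), v ≠ 0 → 0 < h x v v
  contDiffOn : ∀ x₀ : M, ContDiffOn ℝ 1 (bilinCoord h x₀) (extChartAt (𝓡 n) x₀).target

namespace IsRiemannian

variable {h : BilinField n M} (hh : IsRiemannian h) {x₀ : M} {y : Coord n}
include hh

lemma bilinCoord_pos (hy : y ∈ (extChartAt (𝓡 n) x₀).target) (c : Coord n) (hc : c ≠ 0) :
    0 < bilinCoord h x₀ y c c := by
  refine hh.pos _ _ fun h0 => hc ?_
  exact (comps_frame ((extChartAt (𝓡 n) x₀).map_target hy) c).symm.trans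
    ((congrArg (comps (n := n) x₀ _) h0).trans (map_zero _))

lemma gramDet_bilinCoord_pos (hy : y ∈ (extChartAt (𝓡 n) x₀).target) :
    0 < gramDet (bilinCoord h x₀ y) :=
  gramDet_pos (fun _ _ => hh.symm _ _ _) (hh.bilinCoord_pos hy)

lemma density_pos (hy : y ∈ (extChartAt (𝓡 n) x₀).target) : 0 < density h x₀ y :=
  Real.sqrt_pos.2 (hh.gramDet_bilinCoord_pos hy)

lemma contDiffOn_density (x₀ : M) :
    ContDiffOn ℝ 1 (density h x₀) (extChartAt (𝓡 n) x₀).target :=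
  (contDiff_gramDet.comp_contDiffOn (hh.contDiffOn x₀)).sqrt
    fun _ hy => (hh.gramDet_bilinCoord_pos hy).ne'

lemma continuousOn_density (x₀ : M) :
    ContinuousOn (density h x₀) (extChartAt (𝓡 n) x₀).target :=
  (hh.contDiffOn_density x₀).continuousOn

lemma contDiffOn_inverse_bilinCoord (x₀ : M) :
    ContDiffOn ℝ 1 (fun y => (bilinCoord h x₀ y).inverse) (extChartAt (𝓡 n) x₀).target :=
  fun y hy => (contDiffAt_inverse_of_pos (hh.bilinCoord_pos hy)).comp_contDiffWithinAt y
    (hh.contDiffOn x₀ y hy)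

end IsRiemannian

variable [MeasurableSpace M] [BorelSpace M]

lemma aemeasurable_extChartAt_symm (h : BilinField n M) (x₀ : M) :
    AEMeasurable (extChartAt (𝓡 n) x₀).symm
      ((volume.restrict (extChartAt (𝓡 n) x₀).target).withDensity
      (fun y => ENNReal.ofReal (density h x₀ y))) :=
  ((continuousOn_extChartAt_symm x₀).aemeasurable
    (isOpen_extChartAt_target x₀).measurableSet).mono_ac (withDensity_absolutelyContinuous _ _)

lemma chartArea_apply (h : BilinField n M) (x₀ : M) {B : Set M} (hB : MeasurableSet B) :
    chartArea h x₀ B =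
      ∫⁻ y in (extChartAt (𝓡 n) x₀).target ∩ (extChartAt (𝓡 n) x₀).symm ⁻¹' B,
        ENNReal.ofReal (density h x₀ y) := by
  have hT := (isOpen_extChartAt_target (I := 𝓡 n) x₀).measurableSet
  have hm := measurableSet_target_inter_preimage (n := n) x₀ hB
  rw [chartArea, Measure.map_apply_of_aemeasurable (aemeasurable_extChartAt_symm h x₀) hB,
    ← restrict_withDensity hT, Measure.restrict_apply' hT, inter_comm, withDensity_apply _ hm]

lemma chartArea_apply_eq_of_subset (h : BilinField n M) (x₀ x₁ : M) {B : Set M}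
    (hB : MeasurableSet B) (hB₀ : B ⊆ (extChartAt (𝓡 n) x₀).source)
    (hB₁ : B ⊆ (extChartAt (𝓡 n) x₁).source) : chartArea h x₀ B = chartArea h x₁ B := by
  have hA := measurableSet_target_inter_preimage (n := n) x₀ hB
  have hsub : (extChartAt (𝓡 n) x₀).target ∩ (extChartAt (𝓡 n) x₀).symm ⁻¹' B ⊆ overlap x₀ x₁ :=
    fun y hy => ⟨hy.1, hB₁ hy.2⟩
  rw [chartArea_apply h x₀ hB, chartArea_apply h x₁ hB, ← transition_image_preimage hB₀ hB₁,
    lintegral_image_eq_lintegral_abs_det_fderiv_mul volume hA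
      (fun y hy =>
        (hasFDerivAt_transition (hsub hy)).differentiableAt.hasFDerivAt.hasFDerivWithinAt)
      ((injOn_transition x₀ x₁).mono hsub)]
  refine setLIntegral_congr_fun hA fun y hy => ?_
  rw [← ENNReal.ofReal_mul (abs_nonneg _), ← density_eq_abs_det_mul h (hsub hy)]

lemma chartArea_compl_source (h : BilinField n M) (x₀ : M) :
    chartArea h x₀ (extChartAt (𝓡 n) x₀).sourceᶜ = 0 := by
  have hempty : (extChartAt (𝓡 n) x₀).target ∩
      (extChartAt (𝓡 n) x₀).symm ⁻¹' (extChartAt (𝓡 n) x₀).sourceᶜ = ∅ :=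
    eq_empty_of_forall_notMem fun y hy => hy.2 ((extChartAt (𝓡 n) x₀).map_target hy.1)
  rw [chartArea_apply h x₀ (isOpen_extChartAt_source x₀).measurableSet.compl, hempty,
    Measure.restrict_empty, lintegral_zero_measure]

lemma area_apply_of_subset (h : BilinField n M) (x₀ : M) {B : Set M} (hB : MeasurableSet B)
    (hB₀ : B ⊆ (extChartAt (𝓡 n) x₀).source) : area h B = chartArea h x₀ B :=
  iSup_measure_apply_of_agree (U := fun x : M => (extChartAt (𝓡 n) x).source)
    (fun x => (isOpen_extChartAt_source x).measurableSet) (chartArea_compl_source h)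
    (fun _ _ _ hC => chartArea_apply_eq_of_subset h _ _ hC) hB hB₀

lemma restrict_area (h : BilinField n M) (x₀ : M) :
    (area h).restrict (extChartAt (𝓡 n) x₀).source = chartArea h x₀ := by
  ext B hB
  have hS := (isOpen_extChartAt_source (I := 𝓡 n) x₀).measurableSet
  rw [Measure.restrict_apply hB, area_apply_of_subset h x₀ (hB.inter hS) inter_subset_right,
    measure_inter_conull (chartArea_compl_source h x₀)]

namespace IsRiemannian

variable {h : BilinField n M} (hh : IsRiemannian h)
include hh

lemma setIntegral_area (x₀ : M) {f : M → ℝ} (hf : ContinuousOn f (extChartAt (𝓡 n) x₀).source) :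
    ∫ x in (extChartAt (𝓡 n) x₀).source, f x ∂(area h) =
      ∫ y in (extChartAt (𝓡 n) x₀).target,
        density h x₀ y * f ((extChartAt (𝓡 n) x₀).symm y) := by
  have hT := (isOpen_extChartAt_target (I := 𝓡 n) x₀).measurableSet
  have hf' : AEStronglyMeasurable f (chartArea h x₀) := by
    rw [← restrict_area]
    exact hf.aestronglyMeasurable (isOpen_extChartAt_source x₀).measurableSet
  rw [restrict_area, chartArea, integral_map (aemeasurable_extChartAt_symm h x₀) hf',
    integral_withDensity_eq_integral_toReal_smul₀
      ((hh.continuousOn_density x₀).aemeasurable hT).ennreal_ofReal (by simp)]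
  refine setIntegral_congr_fun hT fun y hy => ?_
  rw [smul_eq_mul, ENNReal.toReal_ofReal (hh.density_pos hy).le]

lemma isLocallyFiniteMeasure_area : IsLocallyFiniteMeasure (area h) := by
  refine ⟨fun x => ?_⟩
  set φ := extChartAt (𝓡 n) x
  obtain ⟨r, hr, hball⟩ := Metric.nhds_basis_closedBall.mem_iff.1
    ((isOpen_extChartAt_target (I := 𝓡 n) x).mem_nhds (mem_extChartAt_target x))
  have hU : IsOpen (φ.source ∩ φ ⁻¹' Metric.ball (φ x) r) :=
    (continuousOn_extChartAt x).isOpen_inter_preimage (isOpen_extChartAt_source x)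
      Metric.isOpen_ball
  refine ⟨_, hU.mem_nhds ⟨mem_extChartAt_source x, Metric.mem_ball_self hr⟩, ?_⟩
  have hsub : φ.target ∩ φ.symm ⁻¹' (φ.source ∩ φ ⁻¹' Metric.ball (φ x) r) ⊆
      Metric.closedBall (φ x) r := fun y hy =>
    Metric.ball_subset_closedBall (φ.right_inv hy.1 ▸ hy.2.2)
  have hintegral : IntegrableOn (density h x) (Metric.closedBall (φ x) r) :=
    ((hh.continuousOn_density x).mono hball).integrableOn_compact (isCompact_closedBall _ _)
  rw [area_apply_of_subset h x hU.measurableSet inter_subset_left,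
    chartArea_apply h x hU.measurableSet]
  exact (lintegral_mono_set hsub).trans_lt hintegral.lintegral_lt_top

lemma isOpenPosMeasure_area : (area h).IsOpenPosMeasure := by
  refine ⟨fun U hU ⟨x, hx⟩ h0 => ?_⟩
  set φ := extChartAt (𝓡 n) x
  have hV : IsOpen (U ∩ φ.source) := hU.inter (isOpen_extChartAt_source x)
  have hA : IsOpen (φ.target ∩ φ.symm ⁻¹' (U ∩ φ.source)) :=
    (continuousOn_extChartAt_symm x).isOpen_inter_preimage (isOpen_extChartAt_target x) hV
  have hAne : (φ.target ∩ φ.symm ⁻¹' (U ∩ φ.source)).Nonempty :=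
    ⟨φ x, mem_extChartAt_target x, by
      rw [mem_preimage, extChartAt_to_inv]
      exact ⟨hx, mem_extChartAt_source x⟩⟩
  have hzero :
      ∫⁻ y in φ.target ∩ φ.symm ⁻¹' (U ∩ φ.source), ENNReal.ofReal (density h x y) = 0 := by
    rw [← chartArea_apply h x hV.measurableSet,
      ← area_apply_of_subset h x hV.measurableSet inter_subset_right]
    exact measure_mono_null inter_subset_left h0
  have hmeas : AEMeasurable (fun y => ENNReal.ofReal (density h x y))
      (volume.restrict (φ.target ∩ φ.symm ⁻¹' (U ∩ φ.source))) :=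
    (((hh.continuousOn_density x).mono inter_subset_left).aemeasurable
      hA.measurableSet).ennreal_ofReal
  refine (hA.measure_pos volume hAne).ne' (Measure.restrict_eq_zero.1 ?_)
  rw [← ae_eq_bot, ← Filter.eventually_false_iff_eq_bot]
  filter_upwards [(lintegral_eq_zero_iff' hmeas).1 hzero, ae_restrict_mem hA.measurableSet]
    with y hy hyA
  exact (hh.density_pos hyA.1).not_ge (ENNReal.ofReal_eq_zero.1 hy)

end IsRiemannian

end RiemannianMetrics

/-! ### Integration by parts -/

section IntegrationByParts

lemma integrable_of_continuousOn_of_eq_zero {X : Type*} [TopologicalSpace X] [T2Space X]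
    [MeasurableSpace X] [OpensMeasurableSpace X] {μ : Measure X} [IsFiniteMeasureOnCompacts μ]
    {T K : Set X} (hK : IsCompact K) (hKT : K ⊆ T) {f : X → ℝ} (hf : ContinuousOn f T)
    (h0 : ∀ x ∉ K, f x = 0) : Integrable f μ :=
  (integrableOn_iff_integrable_of_support_subset (Function.support_subset_iff'.2 h0)).1
    ((hf.mono hKT).integrableOn_compact hK)

lemma eventuallyEq_zero_of_notMem {X : Type*} [TopologicalSpace X] {K : Set X} (hK : IsClosed K)
    {f : X → ℝ} (h0 : ∀ x ∉ K, f x = 0) {x : X} (hx : x ∉ K) : f =ᶠ[𝓝 x] fun _ => 0 :=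
  eventually_of_mem (hK.isOpen_compl.mem_nhds hx) h0

lemma fderiv_eq_zero_of_notMem {E : Type*} [NormedAddCommGroup E] [NormedSpace ℝ E] {K : Set E}
    (hK : IsClosed K) {f : E → ℝ} (h0 : ∀ x ∉ K, f x = 0) {x : E} (hx : x ∉ K) :
    fderiv ℝ f x = 0 :=
  (eventuallyEq_zero_of_notMem hK h0 hx).fderiv_eq.trans (fderiv_const_apply 0)

lemma integral_mul_fderiv_eq_neg_of_eq_zero {E : Type*} [NormedAddCommGroup E] [NormedSpace ℝ E]
    [FiniteDimensional ℝ E] [MeasurableSpace E] [BorelSpace E] {μ : Measure E}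
    [μ.IsAddHaarMeasure] {T K : Set E} (hT : IsOpen T) (hK : IsCompact K) (hKT : K ⊆ T)
    {f g : E → ℝ} (hf : ContDiffOn ℝ 1 f T) (hg : ContDiffOn ℝ 1 g T) (h0 : ∀ x ∉ K, f x = 0)
    (v : E) : ∫ x, f x * fderiv ℝ g x v ∂μ = -∫ x, fderiv ℝ f x v * g x ∂μ := by
  have hf' : ContinuousOn (fun x => fderiv ℝ f x v) T :=
    (hf.continuousOn_fderiv_of_isOpen hT le_rfl).clm_apply continuousOn_const
  have hg' : ContinuousOn (fun x => fderiv ℝ g x v) T :=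
    (hg.continuousOn_fderiv_of_isOpen hT le_rfl).clm_apply continuousOn_const
  have hsupp : tsupport f ⊆ T :=
    (closure_minimal (Function.support_subset_iff'.2 h0) hK.isClosed).trans hKT
  refine integral_mul_fderiv_eq_neg_fderiv_mul_of_integrable ?_ ?_ ?_ (fun x _ => ?_) fun x hx =>
    (hg.differentiableOn one_ne_zero).differentiableAt (hT.mem_nhds (hsupp hx))
  · exact integrable_of_continuousOn_of_eq_zero hK hKT (hf'.mul hg.continuousOn)
      fun x hx => by rw [fderiv_eq_zero_of_notMem hK.isClosed h0 hx, zero_apply, zero_mul]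
  · exact integrable_of_continuousOn_of_eq_zero hK hKT (hf.continuousOn.mul hg')
      fun x hx => by rw [h0 x hx, zero_mul]
  · exact integrable_of_continuousOn_of_eq_zero hK hKT (hf.continuousOn.mul hg.continuousOn)
      fun x hx => by rw [h0 x hx, zero_mul]
  · by_cases hx : x ∈ K
    · exact (hf.differentiableOn one_ne_zero).differentiableAt (hT.mem_nhds (hKT hx))
    · exact (eventuallyEq_zero_of_notMem hK.isClosed h0 hx).differentiableAt_iff.2
        (differentiableAt_const _)

variable {n : ℕ} {T K : Set (Coord n)} {u : Coord n → ℝ} {X : Coord n → Coord n}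

lemma integral_fderiv_apply_eq_neg_of_eq_zero (hT : IsOpen T) (hK : IsCompact K) (hKT : K ⊆ T)
    (hu : ContDiffOn ℝ 1 u T) (hX : ContDiffOn ℝ 1 X T) (h0 : ∀ y ∉ K, u y = 0) :
    ∫ y, fderiv ℝ u y (X y) =
      -∫ y, u y * ∑ i, (fderiv ℝ X y (EuclideanSpace.single i 1)) i := by
  let e (i : Fin n) : Coord n := EuclideanSpace.single i 1
  have hXi (i) : ContDiffOn ℝ 1 (fun y => X y i) T :=
    (EuclideanSpace.proj (𝕜 := ℝ) i).contDiff.comp_contDiffOn hX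
  have hlhs (y) : fderiv ℝ u y (X y) = ∑ i, fderiv ℝ u y (e i) * X y i := by
    conv_lhs => rw [← (EuclideanSpace.basisFun (Fin n) ℝ).sum_repr (X y)]
    simp [e, mul_comm]
  have hrhs (y) : u y * ∑ i, (fderiv ℝ X y (e i)) i =
      ∑ i, u y * fderiv ℝ (fun y => X y i) y (e i) := by
    by_cases hy : y ∈ K
    · have hXy := (hX.differentiableOn one_ne_zero).differentiableAt (hT.mem_nhds (hKT hy))
      have hderiv (i) : fderiv ℝ (fun y => X y i) y (e i) = (fderiv ℝ X y (e i)) i :=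
        congrArg (fun l => l (e i))
          ((EuclideanSpace.proj (𝕜 := ℝ) i).hasFDerivAt.comp y hXy.hasFDerivAt).fderiv
      simp only [hderiv, Finset.mul_sum]
    · simp only [h0 y hy, zero_mul, Finset.sum_const_zero]
  have hu' (i) : ContinuousOn (fun y => fderiv ℝ u y (e i)) T :=
    (hu.continuousOn_fderiv_of_isOpen hT le_rfl).clm_apply continuousOn_const
  have hX' (i) : ContinuousOn (fun y => fderiv ℝ (fun y => X y i) y (e i)) T :=
    ((hXi i).continuousOn_fderiv_of_isOpen hT le_rfl).clm_apply continuousOn_const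
  simp_rw [hlhs]
  rw [integral_congr_ae (ae_of_all _ hrhs), integral_finsetSum, integral_finsetSum,
    ← Finset.sum_neg_distrib]
  · refine Finset.sum_congr rfl fun i _ => ?_
    rw [integral_mul_fderiv_eq_neg_of_eq_zero hT hK hKT hu (hXi i) h0, neg_neg]
  · exact fun i _ => integrable_of_continuousOn_of_eq_zero hK hKT (hu.continuousOn.mul (hX' i))
      fun y hy => by rw [h0 y hy, zero_mul]
  · exact fun i _ => integrable_of_continuousOn_of_eq_zero hK hKT
      ((hu' i).mul (hXi i).continuousOn)
      fun y hy => by rw [fderiv_eq_zero_of_notMem hK.isClosed h0 hy, zero_apply, zero_mul]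

lemma setIntegral_fderiv_apply_eq_neg_of_eq_zero (hT : IsOpen T) (hK : IsCompact K) (hKT : K ⊆ T)
    (hu : ContDiffOn ℝ 1 u T) (hX : ContDiffOn ℝ 1 X T) (h0 : ∀ y ∈ T, y ∉ K → u y = 0) :
    ∫ y in T, fderiv ℝ u y (X y) =
      -∫ y in T, u y * ∑ i, (fderiv ℝ X y (EuclideanSpace.single i 1)) i := by
  set w : Coord n → ℝ := T.indicator u
  have hwu : EqOn w u T := fun y hy => indicator_of_mem hy u
  have hw0 : ∀ y ∉ K, w y = 0 := fun y hy => by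
    by_cases hyT : y ∈ T
    · rw [hwu hyT, h0 y hyT hy]
    · exact indicator_of_notMem hyT u
  have hw' {y : Coord n} (hy : y ∈ T) : fderiv ℝ u y = fderiv ℝ w y :=
    (hwu.symm.eventuallyEq_of_mem (hT.mem_nhds hy)).fderiv_eq
  calc ∫ y in T, fderiv ℝ u y (X y) = ∫ y in T, fderiv ℝ w y (X y) :=
        setIntegral_congr_fun hT.measurableSet fun y hy => congrArg (fun l => l (X y)) (hw' hy)
    _ = ∫ y, fderiv ℝ w y (X y) := setIntegral_eq_integral_of_forall_compl_eq_zero fun y hy => by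
        rw [fderiv_eq_zero_of_notMem hK.isClosed hw0 fun hyK => hy (hKT hyK), zero_apply]
    _ = -∫ y, w y * ∑ i, (fderiv ℝ X y (EuclideanSpace.single i 1)) i :=
        integral_fderiv_apply_eq_neg_of_eq_zero hT hK hKT (hu.congr hwu) hX hw0
    _ = -∫ y in T, w y * ∑ i, (fderiv ℝ X y (EuclideanSpace.single i 1)) i := by
        rw [setIntegral_eq_integral_of_forall_compl_eq_zero fun y hy => by
          rw [hw0 y fun hyK => hy (hKT hyK), zero_mul]]
    _ = -∫ y in T, u y * ∑ i, (fderiv ℝ X y (EuclideanSpace.single i 1)) i := by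
        rw [setIntegral_congr_fun hT.measurableSet fun y hy => by rw [hwu hy]]

end IntegrationByParts

/-! ### One-forms and the divergence in coordinates -/

section OneForms

variable {n : ℕ} {M : Type*} [TopologicalSpace M] [ChartedSpace (Coord n) M]

/-- The differential of a function, as a 1-form. -/
def dForm (f : M → ℝ) : OneForm n M := fun x => mfderiv (𝓡 n) 𝓘(ℝ, ℝ) f x

section

variable {f f' : M → ℝ} {x : M}

lemma dForm_eq_zero (hx : x ∉ tsupport f) : dForm (n := n) f x = 0 :=
  (notMem_tsupport_iff_eventuallyEq.1 hx).mfderiv_eq.trans mfderiv_const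

lemma dForm_add (hf : MDifferentiableAt (𝓡 n) 𝓘(ℝ, ℝ) f x)
    (hf' : MDifferentiableAt (𝓡 n) 𝓘(ℝ, ℝ) f' x) :
    dForm (n := n) (f + f') x = dForm f x + dForm f' x :=
  mfderiv_add hf hf'

lemma dForm_smul (t : ℝ) (hf : MDifferentiableAt (𝓡 n) 𝓘(ℝ, ℝ) f x) :
    dForm (n := n) (t • f) x = t • dForm f x :=
  const_smul_mfderiv hf t

lemma dForm_comp_apply {φ : ℝ → ℝ} {φ' : ℝ} (hφ : HasDerivAt φ φ' (f x))
    (hf : MDifferentiableAt (𝓡 n) 𝓘(ℝ, ℝ) f x) (v : TangentSpace (𝓡 n) x) :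
    dForm (fun x => φ (f x)) x v = φ' * dForm f x v := by
  have hcomp : dForm (n := n) (fun x => φ (f x)) x =
      ContinuousLinearMap.toSpanSingleton ℝ φ' ∘L dForm f x :=
    (HasMFDerivAt.comp x hφ.hasFDerivAt.hasMFDerivAt hf.hasMFDerivAt).mfderiv
  rw [hcomp]
  exact mul_comm _ _

lemma normSq_dForm_smul (h : BilinField n M) (t : ℝ)
    (hf : MDifferentiableAt (𝓡 n) 𝓘(ℝ, ℝ) f x) :
    normSq h (dForm (t • f)) x = t ^ 2 * normSq h (dForm f) x := by
  have hsharp : sharp h (dForm (t • f)) x = t • sharp h (dForm f) x := by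
    rw [sharp, dForm_smul t hf]
    exact map_smul (h x).inverse t _
  have hsmul (v) : dForm (n := n) (t • f) x v = t * dForm f x v := by
    rw [dForm_smul t hf]
    rfl
  rw [normSq, hsharp, hsmul, map_smul, smul_eq_mul, normSq]
  ring

end

variable [IsManifold (𝓡 n) ∞ M]

lemma formCoord_apply (a : OneForm n M) (x₀ : M) (y c : Coord n) :
    formCoord a x₀ y c = a ((extChartAt (𝓡 n) x₀).symm y)
      (frame x₀ ((extChartAt (𝓡 n) x₀).symm y) c) := rfl

lemma formCoord_dForm {f : M → ℝ} (hf : ContMDiff (𝓡 n) 𝓘(ℝ, ℝ) 1 f) {x₀ : M} {y : Coord n}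
    (hy : y ∈ (extChartAt (𝓡 n) x₀).target) :
    formCoord (dForm f) x₀ y = fderiv ℝ (fun y => f ((extChartAt (𝓡 n) x₀).symm y)) y := by
  have hderiv : HasFDerivAt (fun y => f ((extChartAt (𝓡 n) x₀).symm y))
      (formCoord (dForm f) x₀ y) y :=
    hasFDerivAt_comp_extChartAt_symm hy ((hf _).mdifferentiableAt one_ne_zero)
  exact hderiv.fderiv.symm

lemma continuousOn_formCoord_dForm {f : M → ℝ} (hf : ContMDiff (𝓡 n) 𝓘(ℝ, ℝ) 1 f) (x₀ : M) :
    ContinuousOn (formCoord (dForm f) x₀) (extChartAt (𝓡 n) x₀).target :=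
  ((contDiffOn_comp_extChartAt_symm (k := 1) hf x₀).continuousOn_fderiv_of_isOpen
    (isOpen_extChartAt_target x₀) le_rfl).congr fun _ hy => formCoord_dForm hf hy

/-- The components of the vector field dual to a 1-form, multiplied by the density of the metric. -/
def dualCoord (h : BilinField n M) (a : OneForm n M) (x₀ : M) (y : Coord n) : Coord n :=
  density h x₀ y • (bilinCoord h x₀ y).inverse (formCoord a x₀ y)

/-- The divergence of a 1-form in the preferred chart around `x₀`; `divergence` is its value at the
centre of the chart. -/
def divCoord (h : BilinField n M) (a : OneForm n M) (x₀ : M) (y : Coord n) : ℝ :=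
  (density h x₀ y)⁻¹ * ∑ i : Fin n,
    (fderiv ℝ (dualCoord h a x₀) y (EuclideanSpace.single i 1)) i

/-- A 1-form with continuously differentiable components. -/
def OneForm.IsC1 (a : OneForm n M) : Prop :=
  ∀ x₀, ContDiffOn ℝ 1 (formCoord a x₀) (extChartAt (𝓡 n) x₀).target

namespace IsRiemannian

variable {h : BilinField n M} (hh : IsRiemannian h)
include hh

lemma apply_injective (x : M) : Function.Injective (h x) :=
  (injective_iff_map_eq_zero (h x)).2 fun _ => eq_zero_of_apply_eq_zero (E := Coord n) (hh.pos x)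

lemma apply_sharp (a : OneForm n M) (x : M) : h x (sharp h a x) = a x :=
  bilin_apply_inverse (E := Coord n) (h x) (fun _ => eq_zero_of_apply_eq_zero (hh.pos x)) _

lemma apply_sharp_symm (a b : OneForm n M) (x : M) : a x (sharp h b x) = b x (sharp h a x) := by
  rw [← hh.apply_sharp a x, ← hh.apply_sharp b x, hh.symm]

lemma frame_inverse_formCoord (a : OneForm n M) {x₀ : M} {y : Coord n}
    (hy : y ∈ (extChartAt (𝓡 n) x₀).target) :
    frame x₀ ((extChartAt (𝓡 n) x₀).symm y) ((bilinCoord h x₀ y).inverse (formCoord a x₀ y)) =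
      sharp h a ((extChartAt (𝓡 n) x₀).symm y) := by
  have hinv := (isInvertible_of_pos (hh.bilinCoord_pos hy)).self_apply_inverse (formCoord a x₀ y)
  refine hh.apply_injective _ ?_
  rw [hh.apply_sharp]
  ext v
  have hv := congrArg (fun l => l (comps (n := n) x₀ _ v)) hinv
  rwa [bilinCoord_apply, formCoord_apply, frame_comps ((extChartAt (𝓡 n) x₀).map_target hy)] at hv

lemma apply_sharp_eq (a b : OneForm n M) {x₀ : M} {y : Coord n}
    (hy : y ∈ (extChartAt (𝓡 n) x₀).target) :
    b ((extChartAt (𝓡 n) x₀).symm y) (sharp h a ((extChartAt (𝓡 n) x₀).symm y)) =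
      formCoord b x₀ y ((bilinCoord h x₀ y).inverse (formCoord a x₀ y)) := by
  rw [formCoord_apply, hh.frame_inverse_formCoord a hy]

lemma contDiffOn_dualCoord {a : OneForm n M} (ha : a.IsC1) (x₀ : M) :
    ContDiffOn ℝ 1 (dualCoord h a x₀) (extChartAt (𝓡 n) x₀).target :=
  (hh.contDiffOn_density x₀).smul ((hh.contDiffOn_inverse_bilinCoord x₀).clm_apply (ha x₀))

lemma continuousOn_divCoord_extChartAt {a : OneForm n M} (ha : a.IsC1) (x₀ : M) :
    ContinuousOn (fun x => divCoord h a x₀ (extChartAt (𝓡 n) x₀ x))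
      (extChartAt (𝓡 n) x₀).source := by
  have hderiv := (hh.contDiffOn_dualCoord ha x₀).continuousOn_fderiv_of_isOpen
    (isOpen_extChartAt_target x₀) le_rfl
  have hdiv : ContinuousOn (divCoord h a x₀) (extChartAt (𝓡 n) x₀).target :=
    ((hh.continuousOn_density x₀).inv₀ fun y hy => (hh.density_pos hy).ne').mul
      (continuousOn_finsetSum _ fun i _ =>
        (EuclideanSpace.proj (𝕜 := ℝ) i).continuous.comp_continuousOn
          (hderiv.clm_apply continuousOn_const))
  exact hdiv.comp (continuousOn_extChartAt x₀) fun _ => (extChartAt (𝓡 n) x₀).map_source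

lemma continuous_apply_sharp {a b : OneForm n M}
    (ha : ∀ x₀, ContinuousOn (formCoord a x₀) (extChartAt (𝓡 n) x₀).target)
    (hb : ∀ x₀, ContinuousOn (formCoord b x₀) (extChartAt (𝓡 n) x₀).target) :
    Continuous fun x => b x (sharp h a x) := by
  refine continuous_iff_continuousAt.2 fun x => ?_
  have hcoord : ContinuousOn
      (fun y => formCoord b x y ((bilinCoord h x y).inverse (formCoord a x y)))
      (extChartAt (𝓡 n) x).target :=
    (hb x).clm_apply ((hh.contDiffOn_inverse_bilinCoord x).continuousOn.clm_apply (ha x))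
  refine ((hcoord.comp (continuousOn_extChartAt x) fun _ =>
    (extChartAt (𝓡 n) x).map_source).continuousAt (extChartAt_source_mem_nhds x)).congr ?_
  filter_upwards [extChartAt_source_mem_nhds (I := 𝓡 n) x] with q hq
  have hsharp := hh.apply_sharp_eq a b ((extChartAt (𝓡 n) x).map_source hq)
  rw [(extChartAt (𝓡 n) x).left_inv hq] at hsharp
  exact hsharp.symm

lemma continuous_dForm_sharp {a : OneForm n M} (ha : a.IsC1) {f : M → ℝ}
    (hf : ContMDiff (𝓡 n) 𝓘(ℝ, ℝ) 1 f) : Continuous fun x => dForm f x (sharp h a x) :=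
  hh.continuous_apply_sharp (fun x => (ha x).continuousOn) (continuousOn_formCoord_dForm hf)

lemma normSq_sub (a b : OneForm n M) (x : M) :
    normSq h (a - b) x = normSq h a x - 2 * b x (sharp h a x) + normSq h b x := by
  have hsharp : sharp h (a - b) x = sharp h a x - sharp h b x :=
    map_sub ((h x).inverse) (a x) (b x)
  have hsub (v) : (a - b) x v = a x v - b x v := rfl
  rw [normSq, hsharp, hsub, map_sub, map_sub, hh.apply_sharp_symm a b, normSq, normSq]
  ring

lemma normSq_nonneg (a : OneForm n M) (x : M) : 0 ≤ normSq h a x := by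
  rw [normSq]
  by_cases h0 : sharp h a x = 0
  · rw [h0, map_zero]
  · exact hh.apply_sharp a x ▸ (hh.pos x _ h0).le

end IsRiemannian

end OneForms

/-! ### The divergence theorem -/

lemma eq_zero_of_forall_nonneg_add_sq {I Q : ℝ} (h : ∀ t : ℝ, 0 ≤ 2 * (t * I) + t ^ 2 * Q) :
    I = 0 := by
  have hdiscrim : discrim Q (2 * I) 0 ≤ 0 := discrim_le_zero fun t => by linarith [h t]
  rw [discrim] at hdiscrim
  exact pow_eq_zero_iff two_ne_zero |>.1 (le_antisymm (by linarith) (sq_nonneg I))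

section DivergenceTheorem

variable {n : ℕ} {M : Type*} [TopologicalSpace M] [ChartedSpace (Coord n) M]
  [IsManifold (𝓡 n) ∞ M] [MeasurableSpace M] [BorelSpace M] {h : BilinField n M} {a : OneForm n M}

namespace IsRiemannian

variable (hh : IsRiemannian h)
include hh

lemma integral_area_of_eq_zero (x₀ : M) {f : M → ℝ}
    (hf : ContinuousOn f (extChartAt (𝓡 n) x₀).source)
    (h0 : ∀ x ∉ (extChartAt (𝓡 n) x₀).source, f x = 0) :
    ∫ x, f x ∂(area h) =
      ∫ y in (extChartAt (𝓡 n) x₀).target,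
        density h x₀ y * f ((extChartAt (𝓡 n) x₀).symm y) := by
  rw [← hh.setIntegral_area x₀ hf, setIntegral_eq_integral_of_forall_compl_eq_zero h0]

variable (ha : a.IsC1)
include ha

lemma integral_dForm_sharp_eq_setIntegral {x₀ : M} {f : M → ℝ}
    (hf : ContMDiff (𝓡 n) 𝓘(ℝ, ℝ) 1 f) (hfs : tsupport f ⊆ (extChartAt (𝓡 n) x₀).source) :
    ∫ x, dForm f x (sharp h a x) ∂(area h) =
      ∫ y in (extChartAt (𝓡 n) x₀).target,
        fderiv ℝ (fun y => f ((extChartAt (𝓡 n) x₀).symm y)) y (dualCoord h a x₀ y) := by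
  rw [hh.integral_area_of_eq_zero x₀ (hh.continuous_dForm_sharp ha hf).continuousOn fun x hx => by
    rw [dForm_eq_zero fun hxf => hx (hfs hxf)]
    rfl]
  refine setIntegral_congr_fun (isOpen_extChartAt_target x₀).measurableSet fun y hy => ?_
  simp only [hh.apply_sharp_eq a (dForm f) hy, formCoord_dForm hf hy, dualCoord, map_smul,
    smul_eq_mul]

lemma integral_mul_divCoord_eq_setIntegral {x₀ : M} {f : M → ℝ} (hf : Continuous f)
    (hfs : tsupport f ⊆ (extChartAt (𝓡 n) x₀).source) :
    ∫ x, f x * divCoord h a x₀ (extChartAt (𝓡 n) x₀ x) ∂(area h) =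
      ∫ y in (extChartAt (𝓡 n) x₀).target, f ((extChartAt (𝓡 n) x₀).symm y) *
        ∑ i, (fderiv ℝ (dualCoord h a x₀) y (EuclideanSpace.single i 1)) i := by
  rw [hh.integral_area_of_eq_zero (f := fun x => f x * divCoord h a x₀ (extChartAt (𝓡 n) x₀ x)) x₀
    (hf.continuousOn.mul (hh.continuousOn_divCoord_extChartAt ha x₀)) fun x hx => by
      rw [image_eq_zero_of_notMem_tsupport fun hxf => hx (hfs hxf), zero_mul]]
  refine setIntegral_congr_fun (isOpen_extChartAt_target x₀).measurableSet fun y hy => ?_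
  have hdensity := (hh.density_pos hy).ne'
  simp only [(extChartAt (𝓡 n) x₀).right_inv hy, divCoord]
  field_simp

lemma integral_dForm_sharp_of_tsupport_subset {x₀ : M} {f : M → ℝ}
    (hf : ContMDiff (𝓡 n) 𝓘(ℝ, ℝ) 1 f) (hfc : HasCompactSupport f)
    (hfs : tsupport f ⊆ (extChartAt (𝓡 n) x₀).source) :
    ∫ x, dForm f x (sharp h a x) ∂(area h) =
      -∫ x, f x * divCoord h a x₀ (extChartAt (𝓡 n) x₀ x) ∂(area h) := by
  rw [hh.integral_dForm_sharp_eq_setIntegral ha hf hfs,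
    hh.integral_mul_divCoord_eq_setIntegral ha hf.continuous hfs]
  refine setIntegral_fderiv_apply_eq_neg_of_eq_zero (K := extChartAt (𝓡 n) x₀ '' tsupport f)
    (isOpen_extChartAt_target x₀)
    (hfc.isCompact.image_of_continuousOn ((continuousOn_extChartAt x₀).mono hfs))
    (image_subset_iff.2 fun x hx => (extChartAt (𝓡 n) x₀).map_source (hfs hx))
    (contDiffOn_comp_extChartAt_symm (k := 1) hf x₀) (hh.contDiffOn_dualCoord ha x₀)
    fun y hy hyf => image_eq_zero_of_notMem_tsupport fun hxf => ?_
  exact hyf ⟨_, hxf, (extChartAt (𝓡 n) x₀).right_inv hy⟩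

variable [T2Space M]

lemma integrable_mul_divCoord {x₀ : M} {f : M → ℝ} (hf : Continuous f)
    (hfc : HasCompactSupport f) (hfs : tsupport f ⊆ (extChartAt (𝓡 n) x₀).source) :
    Integrable (fun x => f x * divCoord h a x₀ (extChartAt (𝓡 n) x₀ x)) (area h) := by
  have := hh.isLocallyFiniteMeasure_area
  exact integrable_of_continuousOn_of_eq_zero hfc hfs
    (hf.continuousOn.mul (hh.continuousOn_divCoord_extChartAt ha x₀))
    fun x hx => by rw [image_eq_zero_of_notMem_tsupport hx, zero_mul]

variable [SigmaCompactSpace M]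

-- Both coordinate expressions have the same integral `-∫ df(a♯) dA` against every test function `f`
-- supported in the overlap of the charts.
lemma divCoord_eq_divCoord {x₀ x₁ q : M} (h₀ : q ∈ (extChartAt (𝓡 n) x₀).source)
    (h₁ : q ∈ (extChartAt (𝓡 n) x₁).source) :
    divCoord h a x₀ (extChartAt (𝓡 n) x₀ q) = divCoord h a x₁ (extChartAt (𝓡 n) x₁ q) := by
  have := hh.isLocallyFiniteMeasure_area
  have := hh.isOpenPosMeasure_area
  set U := (extChartAt (𝓡 n) x₀).source ∩ (extChartAt (𝓡 n) x₁).source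
  have hU : IsOpen U := (isOpen_extChartAt_source x₀).inter (isOpen_extChartAt_source x₁)
  set D : M → M → ℝ := fun x' x => divCoord h a x' (extChartAt (𝓡 n) x' x)
  have hD₀ : ContinuousOn (D x₀) U :=
    (hh.continuousOn_divCoord_extChartAt ha x₀).mono inter_subset_left
  have hD₁ : ContinuousOn (D x₁) U :=
    (hh.continuousOn_divCoord_extChartAt ha x₁).mono inter_subset_right
  have hweak : ∀ᵐ x ∂(area h), x ∈ U → (D x₀ - D x₁) x = 0 := by
    refine hU.ae_eq_zero_of_integral_contMDiff_smul_eq_zero (𝓡 n)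
      ((hD₀.sub hD₁).locallyIntegrableOn hU.measurableSet) fun f hf hfc hfU => ?_
    have hf₁ : ContMDiff (𝓡 n) 𝓘(ℝ, ℝ) 1 f := hf.of_le (by exact_mod_cast le_top)
    have hfs₀ := hfU.trans inter_subset_left
    have hfs₁ := hfU.trans inter_subset_right
    simp only [Pi.sub_apply, smul_eq_mul, mul_sub]
    rw [integral_sub (hh.integrable_mul_divCoord ha hf.continuous hfc hfs₀)
      (hh.integrable_mul_divCoord ha hf.continuous hfc hfs₁), sub_eq_zero, ← neg_inj,
      ← hh.integral_dForm_sharp_of_tsupport_subset ha hf₁ hfc hfs₀,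
      hh.integral_dForm_sharp_of_tsupport_subset ha hf₁ hfc hfs₁]
  have hae : D x₀ =ᵐ[(area h).restrict U] D x₁ := by
    rw [Filter.EventuallyEq, ae_restrict_iff' hU.measurableSet]
    filter_upwards [hweak] with x hx hxU using sub_eq_zero.1 (hx hxU)
  exact Measure.eqOn_open_of_ae_eq hae hU hD₀ hD₁ ⟨h₀, h₁⟩

lemma divergence_eq_divCoord {x₀ q : M} (hq : q ∈ (extChartAt (𝓡 n) x₀).source) :
    divergence h a q = divCoord h a x₀ (extChartAt (𝓡 n) x₀ q) :=
  hh.divCoord_eq_divCoord ha (mem_extChartAt_source q) hq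

lemma continuous_divergence : Continuous (divergence h a) := by
  refine continuous_iff_continuousAt.2 fun x => ?_
  have hx := extChartAt_source_mem_nhds (I := 𝓡 n) x
  refine ((hh.continuousOn_divCoord_extChartAt ha x).continuousAt hx).congr ?_
  filter_upwards [hx] with q hq using (hh.divergence_eq_divCoord ha hq).symm

end IsRiemannian

variable [T2Space M] [CompactSpace M]

lemma IsRiemannian.integrable_of_continuous (hh : IsRiemannian h) {f : M → ℝ}
    (hf : Continuous f) : Integrable f (area h) := by
  have := hh.isLocallyFiniteMeasure_area
  exact integrable_of_continuousOn_of_eq_zero isCompact_univ subset_rfl hf.continuousOn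
    fun x hx => absurd (mem_univ x) hx

/-- The function `f` satisfies `∫ df(a♯) dA = -∫ f div a dA`, the divergence theorem for the vector
field dual to `f a`. -/
structure SatisfiesGreen (h : BilinField n M) (a : OneForm n M) (f : M → ℝ) : Prop where
  contMDiff : ContMDiff (𝓡 n) 𝓘(ℝ, ℝ) 1 f
  integral_eq :
    ∫ x, dForm f x (sharp h a x) ∂(area h) = -∫ x, f x * divergence h a x ∂(area h)

namespace IsRiemannian

variable (hh : IsRiemannian h) (ha : a.IsC1)
include hh ha

lemma satisfiesGreen_add {f f' : M → ℝ} (hf : SatisfiesGreen h a f)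
    (hf' : SatisfiesGreen h a f') : SatisfiesGreen h a (f + f') where
  contMDiff := hf.contMDiff.add hf'.contMDiff
  integral_eq := by
    have hdForm (x) : dForm (f + f') x (sharp h a x) =
        dForm f x (sharp h a x) + dForm f' x (sharp h a x) := by
      rw [dForm_add ((hf.contMDiff x).mdifferentiableAt one_ne_zero)
        ((hf'.contMDiff x).mdifferentiableAt one_ne_zero)]
      rfl
    have hdiv {f : M → ℝ} (hf : SatisfiesGreen h a f) :
        Integrable (fun x => f x * divergence h a x) (area h) :=
      hh.integrable_of_continuous (hf.contMDiff.continuous.mul (hh.continuous_divergence ha))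
    simp only [hdForm, Pi.add_apply, add_mul]
    rw [integral_add (hh.integrable_of_continuous (hh.continuous_dForm_sharp ha hf.contMDiff))
      (hh.integrable_of_continuous (hh.continuous_dForm_sharp ha hf'.contMDiff)),
      integral_add (hdiv hf) (hdiv hf'), hf.integral_eq, hf'.integral_eq, neg_add]

lemma satisfiesGreen_of_tsupport_subset {x₀ : M} {f : M → ℝ}
    (hf : ContMDiff (𝓡 n) 𝓘(ℝ, ℝ) 1 f) (hfs : tsupport f ⊆ (extChartAt (𝓡 n) x₀).source) :
    SatisfiesGreen h a f where
  contMDiff := hf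
  integral_eq := by
    rw [hh.integral_dForm_sharp_of_tsupport_subset ha hf (HasCompactSupport.of_compactSpace f) hfs]
    congr 1
    refine integral_congr_ae (ae_of_all _ fun x => ?_)
    by_cases hx : x ∈ (extChartAt (𝓡 n) x₀).source
    · simp only [hh.divergence_eq_divCoord ha hx]
    · simp only [image_eq_zero_of_notMem_tsupport fun hxf => hx (hfs hxf), zero_mul]

lemma satisfiesGreen {f : M → ℝ} (hf : ContMDiff (𝓡 n) 𝓘(ℝ, ℝ) 1 f) :
    SatisfiesGreen h a f := by
  obtain ⟨t, ht⟩ := isCompact_univ.elim_finite_subcover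
    (fun x : M => (extChartAt (𝓡 n) x).source) (fun x => isOpen_extChartAt_source x)
    fun x _ => mem_iUnion.2 ⟨x, mem_extChartAt_source x⟩
  obtain ⟨ρ, hρ⟩ := SmoothPartitionOfUnity.exists_isSubordinate (𝓡 n) isClosed_univ
    (fun x : t => (extChartAt (𝓡 n) (x : M)).source) (fun x => isOpen_extChartAt_source _)
    (ht.trans (iUnion₂_subset fun x hx => subset_iUnion_of_subset ⟨x, hx⟩ subset_rfl))
  have hdForm_zero (x) : dForm (n := n) (0 : M → ℝ) x = 0 := mfderiv_const
  have hzero : SatisfiesGreen h a 0 := ⟨contMDiff_const, by simp [hdForm_zero]⟩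
  have hpart (i : t) : SatisfiesGreen h a fun x => ρ i x * f x :=
    hh.satisfiesGreen_of_tsupport_subset ha
      (((ρ i).contMDiff.of_le (by exact_mod_cast le_top)).mul hf)
      (tsupport_mul_subset_left.trans (hρ i))
  have hsum : ∑ i : t, (fun x => ρ i x * f x) = f := by
    ext x
    rw [Finset.sum_apply, ← Finset.sum_mul, ← finsum_eq_sum_of_fintype,
      ρ.sum_eq_one (mem_univ x), one_mul]
  rw [← hsum]
  exact Finset.sum_induction _ (SatisfiesGreen h a)
    (fun _ _ => hh.satisfiesGreen_add ha) hzero fun i _ => hpart i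

lemma integral_normSq_sub_dForm {f : M → ℝ} (hf : ContMDiff (𝓡 n) 𝓘(ℝ, ℝ) 1 f) :
    ∫ x, normSq h (a - dForm f) x ∂(area h) = ∫ x, normSq h a x ∂(area h) +
      2 * ∫ x, f x * divergence h a x ∂(area h) + ∫ x, normSq h (dForm f) x ∂(area h) := by
  have ha₀ (x) := (ha x).continuousOn
  have hdf := continuousOn_formCoord_dForm hf
  have hint_a : Integrable (normSq h a) (area h) :=
    hh.integrable_of_continuous (hh.continuous_apply_sharp ha₀ ha₀)
  have hint_cross : Integrable (fun x => 2 * dForm f x (sharp h a x)) (area h) :=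
    (hh.integrable_of_continuous (hh.continuous_dForm_sharp ha hf)).const_mul 2
  have hint_df : Integrable (normSq h (dForm f)) (area h) :=
    hh.integrable_of_continuous (hh.continuous_apply_sharp hdf hdf)
  simp only [hh.normSq_sub]
  rw [integral_add (f := fun x => normSq h a x - 2 * dForm f x (sharp h a x))
    (hint_a.sub hint_cross) hint_df, integral_sub hint_a hint_cross, integral_const_mul,
    (hh.satisfiesGreen ha hf).integral_eq]
  ring

lemma integral_mul_divergence_eq_zero
    (hmin : ∀ f : M → ℝ, ContMDiff (𝓡 n) 𝓘(ℝ, ℝ) ∞ f →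
      ∫ x, normSq h a x ∂(area h) ≤ ∫ x, normSq h (a - dForm f) x ∂(area h))
    {f : M → ℝ} (hf : ContMDiff (𝓡 n) 𝓘(ℝ, ℝ) ∞ f) :
    ∫ x, f x * divergence h a x ∂(area h) = 0 := by
  have h₁ : (1 : WithTop ℕ∞) ≤ ∞ := by exact_mod_cast le_top
  refine eq_zero_of_forall_nonneg_add_sq (Q := ∫ x, normSq h (dForm f) x ∂(area h)) fun t => ?_
  have htf : ContMDiff (𝓡 n) 𝓘(ℝ, ℝ) ∞ (t • f) := (contDiff_const_smul t).contMDiff.comp hf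
  have hlinear : ∫ x, (t • f) x * divergence h a x ∂(area h) =
      t * ∫ x, f x * divergence h a x ∂(area h) := by
    simp only [Pi.smul_apply, smul_eq_mul, mul_assoc, integral_const_mul]
  have hquadratic : ∫ x, normSq h (dForm (t • f)) x ∂(area h) =
      t ^ 2 * ∫ x, normSq h (dForm f) x ∂(area h) := by
    simp only [normSq_dForm_smul h t (((hf.of_le h₁) _).mdifferentiableAt one_ne_zero),
      integral_const_mul]
  have := hmin (t • f) htf
  rw [hh.integral_normSq_sub_dForm ha (htf.of_le h₁), hlinear, hquadratic] at this
  linarith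

theorem forall_integral_normSq_le_iff :
    (∀ f : M → ℝ, ContMDiff (𝓡 n) 𝓘(ℝ, ℝ) ∞ f →
      ∫ x, normSq h a x ∂(area h) ≤ ∫ x, normSq h (a - dForm f) x ∂(area h)) ↔
      ∀ x, divergence h a x = 0 := by
  refine ⟨fun hmin => ?_, fun hdiv f hf => ?_⟩
  · have := hh.isLocallyFiniteMeasure_area
    have := hh.isOpenPosMeasure_area
    have hcont := hh.continuous_divergence ha
    have hae : divergence h a =ᵐ[area h] 0 :=
      ae_eq_zero_of_integral_contMDiff_smul_eq_zero (𝓡 n) hcont.locallyIntegrable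
        fun f hf _ => hh.integral_mul_divergence_eq_zero ha hmin hf
    exact congrFun ((hcont.ae_eq_iff_eq (area h) continuous_const).1 hae)
  · rw [hh.integral_normSq_sub_dForm ha (hf.of_le (by exact_mod_cast le_top))]
    simp only [hdiv, mul_zero, integral_zero, add_zero]
    exact le_add_of_nonneg_right (integral_nonneg fun x => hh.normSq_nonneg _ x)

end IsRiemannian

end DivergenceTheorem

/-! ### The Levi-Civita connection in coordinates -/

section CovDerivPairing

variable {D E : Type*} [NormedAddCommGroup D] [NormedSpace ℝ D] [NormedAddCommGroup E]
  [NormedSpace ℝ E] {F : Type*} [NormedAddCommGroup F] [NormedSpace ℝ F]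

lemma fderiv_bilin_comp_apply {B : F → E →L[ℝ] E →L[ℝ] ℝ} {σ : D → F} {V W : D → E} {y : D}
    (hB : DifferentiableAt ℝ B (σ y)) (hσ : DifferentiableAt ℝ σ y)
    (hV : DifferentiableAt ℝ V y) (hW : DifferentiableAt ℝ W y) (c : D) :
    fderiv ℝ (fun z => B (σ z) (V z) (W z)) y c = fderiv ℝ B (σ y) (fderiv ℝ σ y c) (V y) (W y) +
      B (σ y) (fderiv ℝ V y c) (W y) + B (σ y) (V y) (fderiv ℝ W y c) := by
  have hBσ := HasFDerivAt.comp (G := E →L[ℝ] E →L[ℝ] ℝ) y hB.hasFDerivAt hσ.hasFDerivAt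
  have h := ((hBσ.clm_apply hV.hasFDerivAt).clm_apply hW.hasFDerivAt).fderiv
  simp only [Function.comp_apply] at h
  rw [h]
  simp only [add_apply, ContinuousLinearMap.comp_apply, ContinuousLinearMap.flip_apply]
  ring

lemma fderiv_bilin_const_apply {B : D → E →L[ℝ] E →L[ℝ] ℝ} {y : D}
    (hB : DifferentiableAt ℝ B y) (c : D) (v w : E) :
    fderiv ℝ (fun z => B z v w) y c = fderiv ℝ B y c v w := by
  simpa using fderiv_bilin_comp_apply (σ := id) hB differentiableAt_id
    (differentiableAt_const v) (differentiableAt_const w) c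

lemma fderiv_bilin_symm {B : D → E →L[ℝ] E →L[ℝ] ℝ} {y : D} (hB : DifferentiableAt ℝ B y)
    (hsymm : ∀ z v w, B z v w = B z w v) (c : D) (v w : E) :
    fderiv ℝ B y c v w = fderiv ℝ B y c w v := by
  rw [← fderiv_bilin_const_apply hB, ← fderiv_bilin_const_apply hB]
  simp only [hsymm _ v w]

/-- The Christoffel symbols of the first kind, as a function of the derivative `B` of the metric:
`christoffelForm B v u w` is `Γ_{kij} wᵏ uⁱ vʲ`. -/
def christoffelForm (B : E →L[ℝ] E →L[ℝ] E →L[ℝ] ℝ) (v u w : E) : ℝ :=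
  1 / 2 * (B u v w + B v u w - B w v u)

lemma christoffelForm_add (B : E →L[ℝ] E →L[ℝ] E →L[ℝ] ℝ) (v v' u w : E) :
    christoffelForm B (v + v') u w = christoffelForm B v u w + christoffelForm B v' u w := by
  simp only [christoffelForm, B.map_add, (B _).map_add, add_apply]
  ring

lemma christoffelForm_smul (B : E →L[ℝ] E →L[ℝ] E →L[ℝ] ℝ) (a : ℝ) (v u w : E) :
    christoffelForm B (a • v) u w = a * christoffelForm B v u w := by
  simp only [christoffelForm, B.map_smul, map_smul (B _), smul_apply, smul_eq_mul]
  ring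

lemma christoffelForm_add_swap {B : E →L[ℝ] E →L[ℝ] E →L[ℝ] ℝ}
    (hB : ∀ u v w, B u v w = B u w v) (v u w : E) :
    christoffelForm B v u w + christoffelForm B w u v = B u v w := by
  rw [christoffelForm, christoffelForm, hB v w u, hB w v u, hB u w v]
  ring

lemma fderiv_pullbackForm_apply {G G₀ : E → E →L[ℝ] E →L[ℝ] ℝ} {τ : E → E} {x : E}
    (hG₀ : DifferentiableAt ℝ G₀ x) (hG : DifferentiableAt ℝ G (τ x)) (hτ : ContDiffAt ℝ 2 τ x)
    (h : ∀ᶠ z in 𝓝 x, G₀ z = pullbackForm (G (τ z)) (fderiv ℝ τ z)) (u v w : E) :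
    fderiv ℝ G₀ x u v w =
      fderiv ℝ G (τ x) (fderiv ℝ τ x u) (fderiv ℝ τ x v) (fderiv ℝ τ x w) +
        G (τ x) (fderiv ℝ (fderiv ℝ τ) x u v) (fderiv ℝ τ x w) +
        G (τ x) (fderiv ℝ τ x v) (fderiv ℝ (fderiv ℝ τ) x u w) := by
  have hτ' : DifferentiableAt ℝ (fderiv ℝ τ) x :=
    (hτ.fderiv_right (m := 1) (by norm_num)).differentiableAt one_ne_zero
  have hderiv (v : E) :
      HasFDerivAt (fun z => fderiv ℝ τ z v) ((fderiv ℝ (fderiv ℝ τ) x).flip v) x := by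
    simpa using hτ'.hasFDerivAt.clm_apply (hasFDerivAt_const v x)
  have heq : (fun z => G₀ z v w) =ᶠ[𝓝 x] fun z => G (τ z) (fderiv ℝ τ z v) (fderiv ℝ τ z w) := by
    filter_upwards [h] with z hz
    rw [hz, pullbackForm_apply]
  rw [← fderiv_bilin_const_apply hG₀, heq.fderiv_eq,
    fderiv_bilin_comp_apply hG (hτ.differentiableAt two_ne_zero)
      (hderiv v).differentiableAt (hderiv w).differentiableAt, (hderiv v).fderiv, (hderiv w).fderiv]
  rfl

lemma christoffelForm_pullbackForm {G G₀ : E → E →L[ℝ] E →L[ℝ] ℝ} {τ : E → E} {x : E}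
    (hG₀ : DifferentiableAt ℝ G₀ x) (hG : DifferentiableAt ℝ G (τ x)) (hτ : ContDiffAt ℝ 2 τ x)
    (hsymm : ∀ v w, G (τ x) v w = G (τ x) w v)
    (h : ∀ᶠ z in 𝓝 x, G₀ z = pullbackForm (G (τ z)) (fderiv ℝ τ z)) (v u w : E) :
    christoffelForm (fderiv ℝ G₀ x) v u w =
      christoffelForm (fderiv ℝ G (τ x)) (fderiv ℝ τ x v) (fderiv ℝ τ x u) (fderiv ℝ τ x w) +
        G (τ x) (fderiv ℝ τ x w) (fderiv ℝ (fderiv ℝ τ) x u v) := by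
  have hτsymm (a b : E) : fderiv ℝ (fderiv ℝ τ) x a b = fderiv ℝ (fderiv ℝ τ) x b a :=
    hτ.isSymmSndFDerivAt (by simp) a b
  simp only [christoffelForm, fderiv_pullbackForm_apply hG₀ hG hτ h]
  rw [hτsymm v u, hτsymm w u, hτsymm w v, hsymm (fderiv ℝ τ x v), hsymm (fderiv ℝ τ x u),
    hsymm _ (fderiv ℝ τ x w)]
  ring

/-- The pairing `⟨w, ∇_c V⟩` at `y` of a vector `w` with the Levi-Civita covariant derivative of a
vector field `V` along `σ`, for the metric `G` on an open subset of `E`. Pairing with `w` avoids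
raising the index of the Christoffel symbols. -/
def covDerivPairing (G : E → E →L[ℝ] E →L[ℝ] ℝ) (σ V : D → E) (y c : D) (w : E) : ℝ :=
  G (σ y) w (fderiv ℝ V y c) + christoffelForm (fderiv ℝ G (σ y)) (V y) (fderiv ℝ σ y c) w

variable {G G₀ : E → E →L[ℝ] E →L[ℝ] ℝ} {σ V W : D → E} {y : D}

lemma covDerivPairing_congr {σ' V' : D → E} (hσ : σ =ᶠ[𝓝 y] σ') (hV : V =ᶠ[𝓝 y] V') (c : D)
    (w : E) : covDerivPairing G σ V y c w = covDerivPairing G σ' V' y c w := by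
  rw [covDerivPairing, covDerivPairing, hσ.fderiv_eq, hV.fderiv_eq, hσ.eq_of_nhds, hV.eq_of_nhds]

lemma covDerivPairing_add (hV : DifferentiableAt ℝ V y) (hW : DifferentiableAt ℝ W y) (c : D)
    (w : E) : covDerivPairing G σ (fun z => V z + W z) y c w =
      covDerivPairing G σ V y c w + covDerivPairing G σ W y c w := by
  simp only [covDerivPairing, fderiv_fun_add hV hW, add_apply, map_add, christoffelForm_add]
  ring

lemma covDerivPairing_smul {f : D → ℝ} (hf : DifferentiableAt ℝ f y)
    (hV : DifferentiableAt ℝ V y) (c : D) (w : E) :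
    covDerivPairing G σ (fun z => f z • V z) y c w =
      fderiv ℝ f y c * G (σ y) w (V y) + f y * covDerivPairing G σ V y c w := by
  simp only [covDerivPairing, fderiv_fun_smul hf hV, add_apply, smul_apply, map_add, map_smul,
    ContinuousLinearMap.smulRight_apply, christoffelForm_smul, smul_eq_mul]
  ring

lemma fderiv_metric_eq_covDerivPairing (hG : DifferentiableAt ℝ G (σ y))
    (hsymm : ∀ x v w, G x v w = G x w v) (hσ : DifferentiableAt ℝ σ y)
    (hV : DifferentiableAt ℝ V y) (hW : DifferentiableAt ℝ W y) (c : D) :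
    fderiv ℝ (fun z => G (σ z) (V z) (W z)) y c =
      covDerivPairing G σ V y c (W y) + covDerivPairing G σ W y c (V y) := by
  rw [fderiv_bilin_comp_apply hG hσ hV hW,
    ← christoffelForm_add_swap (fderiv_bilin_symm hG hsymm), covDerivPairing, covDerivPairing,
    hsymm _ (W y)]
  ring

lemma covDerivPairing_comp {τ : E → E} (hG₀ : DifferentiableAt ℝ G₀ (σ y))
    (hG : DifferentiableAt ℝ G (τ (σ y))) (hτ : ContDiffAt ℝ 2 τ (σ y))
    (hsymm : ∀ v w, G (τ (σ y)) v w = G (τ (σ y)) w v)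
    (h : ∀ᶠ x in 𝓝 (σ y), G₀ x = pullbackForm (G (τ x)) (fderiv ℝ τ x))
    (hσ : DifferentiableAt ℝ σ y) (hV : DifferentiableAt ℝ V y) (c : D) (w : E) :
    covDerivPairing G (fun z => τ (σ z)) (fun z => fderiv ℝ τ (σ z) (V z)) y c
      (fderiv ℝ τ (σ y) w) = covDerivPairing G₀ σ V y c w := by
  have hτ' : DifferentiableAt ℝ (fderiv ℝ τ) (σ y) :=
    (hτ.fderiv_right (m := 1) (by norm_num)).differentiableAt one_ne_zero
  have hτσ : HasFDerivAt (fun z => τ (σ z)) (fderiv ℝ τ (σ y) ∘L fderiv ℝ σ y) y :=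
    (hτ.differentiableAt two_ne_zero).hasFDerivAt.comp y hσ.hasFDerivAt
  have hτ'σ : HasFDerivAt (fun z => fderiv ℝ τ (σ z))
      (fderiv ℝ (fderiv ℝ τ) (σ y) ∘L fderiv ℝ σ y) y :=
    HasFDerivAt.comp (G := E →L[ℝ] E) y hτ'.hasFDerivAt hσ.hasFDerivAt
  rw [covDerivPairing, covDerivPairing, christoffelForm_pullbackForm hG₀ hG hτ hsymm h,
    h.self_of_nhds, pullbackForm_apply, hτσ.fderiv, (hτ'σ.clm_apply hV.hasFDerivAt).fderiv]
  simp only [add_apply, ContinuousLinearMap.comp_apply, ContinuousLinearMap.flip_apply, map_add]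
  ring

lemma contDiffOn_covDerivPairing {X : Set E} {Y : Set D} {w : D → E} (hX : IsOpen X)
    (hY : IsOpen Y) (hG : ContDiffOn ℝ ∞ G X) (hσ : ContDiffOn ℝ ∞ σ Y) (hmaps : MapsTo σ Y X)
    (hV : ContDiffOn ℝ ∞ V Y) (hw : ContDiffOn ℝ ∞ w Y) (c : D) :
    ContDiffOn ℝ ∞ (fun z => covDerivPairing G σ V z c (w z)) Y := by
  have hG' {a b d : D → E} (ha : ContDiffOn ℝ ∞ a Y) (hb : ContDiffOn ℝ ∞ b Y)
      (hd : ContDiffOn ℝ ∞ d Y) :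
      ContDiffOn ℝ ∞ (fun z => fderiv ℝ G (σ z) (a z) (b z) (d z)) Y :=
    ((((hG.fderiv_of_isOpen hX (m := ∞) (by simp)).comp hσ hmaps).clm_apply ha).clm_apply
      hb).clm_apply hd
  have hdir {a : D → E} (ha : ContDiffOn ℝ ∞ a Y) : ContDiffOn ℝ ∞ (fun z => fderiv ℝ a z c) Y :=
    (ha.fderiv_of_isOpen hY (m := ∞) (by simp)).clm_apply contDiffOn_const
  have hσ' := hdir hσ
  exact (((hG.comp hσ hmaps).clm_apply hw).clm_apply (hdir hV)).add
    (contDiffOn_const.mul (((hG' hσ' hV hw).add (hG' hV hσ' hw)).sub (hG' hw hV hσ')))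

end CovDerivPairing

/-! ### Coordinates of vector fields along a map into a spacetime -/

section LocalRepresentatives

variable {N : Type*} [TopologicalSpace N] [ChartedSpace (Coord 4) N] [IsManifold (𝓡 4) ∞ N]

lemma trivializationAt_snd {z₀ x : N} (hx : x ∈ (extChartAt (𝓡 4) z₀).source)
    (v : TangentSpace (𝓡 4) x) :
    (trivializationAt (Coord 4) (TangentSpace (𝓡 4)) z₀ ⟨x, v⟩).2 = comps z₀ x v := by
  rw [extChartAt_source] at hx
  exact (congrFun ((trivializationAt (Coord 4) (TangentSpace (𝓡 4)) z₀).coe_linearMapAt_of_mem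
    (R := ℝ) hx) v).symm

lemma contMDiffOn_frame (z₀ : N) (c : Coord 4) :
    ContMDiffOn (𝓡 4) (𝓡 4).tangent ∞
      (fun x => (⟨x, frame z₀ x c⟩ : TangentBundle (𝓡 4) N)) (extChartAt (𝓡 4) z₀).source := by
  refine ((trivializationAt (Coord 4) (TangentSpace (𝓡 4)) z₀).contMDiffOn_iff
    fun x hx => (Trivialization.mem_source _).2 ?_).2 ⟨contMDiffOn_id, ?_⟩
  · rwa [extChartAt_source] at hx
  · exact (contMDiffOn_const (c := c)).congr fun x hx =>
      (trivializationAt_snd hx _).trans (comps_frame hx c)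

lemma LorentzMetric.contDiffOn_bilinCoord (g : LorentzMetric N) (z₀ : N) :
    ContDiffOn ℝ ∞ (bilinCoord g.val z₀) (extChartAt (𝓡 4) z₀).target := by
  refine contDiffOn_clm_apply.2 fun c => contDiffOn_clm_apply.2 fun d => ?_
  have hg : ContMDiffOn (𝓡 4) 𝓘(ℝ, ℝ) ∞ (fun x => g.val x (frame z₀ x c) (frame z₀ x d))
      (extChartAt (𝓡 4) z₀).source := fun x hx =>
    (contMDiffWithinAt_totalSpace.1 (ContMDiffOn.clm_bundle_apply₂ (F₁ := Coord 4) (F₂ := Coord 4)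
      (F₃ := ℝ) (E₃ := Bundle.Trivial N ℝ) g.smooth.contMDiffOn (contMDiffOn_frame z₀ c)
      (contMDiffOn_frame z₀ d) x hx)).2
  rw [← contMDiffOn_iff_contDiffOn]
  exact hg.comp (contMDiffOn_extChartAt_symm z₀) fun y hy => (extChartAt (𝓡 4) z₀).map_target hy

lemma LorentzMetric.differentiableAt_bilinCoord (g : LorentzMetric N) {z₀ : N} {x : Coord 4}
    (hx : x ∈ (extChartAt (𝓡 4) z₀).target) : DifferentiableAt ℝ (bilinCoord g.val z₀) x :=
  ((g.contDiffOn_bilinCoord z₀).differentiableOn (by simp)).differentiableAt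
    ((isOpen_extChartAt_target z₀).mem_nhds hx)

lemma LorentzMetric.bilinCoord_symm (g : LorentzMetric N) (z₀ : N) (x v w : Coord 4) :
    bilinCoord g.val z₀ x v w = bilinCoord g.val z₀ x w v := g.symm _ _ _

lemma LorentzMetric.bilinCoord_apply_inverse (g : LorentzMetric N) {z₀ : N} {x : Coord 4}
    (hx : x ∈ (extChartAt (𝓡 4) z₀).target) (l : Coord 4 →L[ℝ] ℝ) :
    bilinCoord g.val z₀ x ((bilinCoord g.val z₀ x).inverse l) = l := by
  refine bilin_apply_inverse _ (fun v hv => ?_) l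
  have hsource := (extChartAt (𝓡 4) z₀).map_target hx
  have hzero : frame z₀ ((extChartAt (𝓡 4) z₀).symm x) v = 0 := by
    refine nondegenerate g _ _ fun w => ?_
    have h := congrArg (fun l : Coord 4 →L[ℝ] ℝ => l (comps z₀ _ w)) hv
    rwa [bilinCoord_apply, frame_comps hsource] at h
  exact (comps_frame hsource v).symm.trans
    ((congrArg (comps z₀ _) hzero).trans (map_zero _))

lemma comps_eq_fderiv_transition {z₀ z₁ x : N} (h₀ : x ∈ (extChartAt (𝓡 4) z₀).source)
    (h₁ : x ∈ (extChartAt (𝓡 4) z₁).source) (v : TangentSpace (𝓡 4) x) :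
    comps z₁ x v =
      fderiv ℝ (transition z₀ z₁) (extChartAt (𝓡 4) z₀ x) (comps z₀ x v) := by
  have h := frame_eq_frame_fderiv_transition (extChartAt_mem_mapDomain (f := id) h₀ h₁)
    (comps z₀ x v)
  rw [(extChartAt (𝓡 4) z₀).left_inv h₀, frame_comps h₀] at h
  conv_lhs => rw [h]
  exact comps_frame h₁ _

variable {S : Type*} [TopologicalSpace S] [ChartedSpace (Coord 2) S] {Φ : S → N}

/-- The components of a vector field along `Φ` in the charts around `p₀` and `z₀`. -/
def fieldCoord (V : FieldAlong Φ) (p₀ : S) (z₀ : N) (y : Coord 2) : Coord 4 :=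
  comps z₀ (Φ ((extChartAt (𝓡 2) p₀).symm y)) (V ((extChartAt (𝓡 2) p₀).symm y))

lemma metric_apply_eq (g : LorentzMetric N) {p₀ : S} {z₀ : N} {y : Coord 2}
    (hy : y ∈ mapDomain (n := 2) (m := 4) Φ p₀ z₀)
    (v w : TangentSpace (𝓡 4) (Φ ((extChartAt (𝓡 2) p₀).symm y))) :
    g.val (Φ ((extChartAt (𝓡 2) p₀).symm y)) v w =
      bilinCoord g.val z₀ (mapCoord Φ p₀ z₀ y) (comps z₀ _ v) (comps z₀ _ w) := by
  have hinv : (extChartAt (𝓡 4) z₀).symm (mapCoord (n := 2) (m := 4) Φ p₀ z₀ y) =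
    Φ ((extChartAt (𝓡 2) p₀).symm y) := (extChartAt (𝓡 4) z₀).left_inv hy.2
  rw [bilinCoord_apply, hinv, frame_comps hy.2, frame_comps hy.2]

lemma FieldAlong.smooth_of_contDiffOn (hΦ : ContMDiff (𝓡 2) (𝓡 4) ∞ Φ) {V : FieldAlong Φ}
    (hV : ∀ p₀ z₀, ContDiffOn ℝ ∞ (fieldCoord V p₀ z₀) (mapDomain (n := 2) (m := 4) Φ p₀ z₀)) :
    V.Smooth := by
  intro p
  refine contMDiffAt_totalSpace.2 ⟨hΦ p, ?_⟩
  have hmem : extChartAt (𝓡 2) p p ∈ mapDomain (n := 2) (m := 4) Φ p (Φ p) :=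
    extChartAt_mem_mapDomain (mem_extChartAt_source p) (mem_extChartAt_source (Φ p))
  have hcomps : ContMDiffAt (𝓡 2) 𝓘(ℝ, Coord 4) ∞ (fun q => comps (Φ p) (Φ q) (V q)) p :=
    contMDiffAt_of_comp_extChartAt_symm (k := ⊤) ((hV p (Φ p)).contDiffAt
      ((isOpen_mapDomain hΦ.continuous p (Φ p)).mem_nhds hmem))
  refine hcomps.congr_of_eventuallyEq ?_
  filter_upwards [hΦ.continuous.continuousAt.preimage_mem_nhds
    (extChartAt_source_mem_nhds (I := 𝓡 4) (Φ p))] with q hq using trivializationAt_snd hq _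

lemma FieldAlong.Smooth.mdifferentiableAt_comps {V : FieldAlong Φ} (hV : V.Smooth) (q : S) :
    MDifferentiableAt (𝓡 2) 𝓘(ℝ, Coord 4) (fun p => comps (Φ q) (Φ p) (V p)) q := by
  obtain ⟨hΦ, hsnd⟩ := contMDiffAt_totalSpace.1 (hV q)
  refine (hsnd.congr_of_eventuallyEq ?_).mdifferentiableAt (by simp)
  filter_upwards [hΦ.continuousAt.preimage_mem_nhds
    (extChartAt_source_mem_nhds (I := 𝓡 4) (Φ q))] with p hp using (trivializationAt_snd hp _).symm

variable [IsManifold (𝓡 2) ∞ S]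

lemma FieldAlong.Smooth.contDiffOn_fieldCoord {V : FieldAlong Φ} (hV : V.Smooth) (p₀ : S)
    (z₀ : N) :
    ContDiffOn ℝ ∞ (fieldCoord V p₀ z₀) (mapDomain (n := 2) (m := 4) Φ p₀ z₀) := by
  have hsmooth : ContMDiffOn 𝓘(ℝ, Coord 2) (𝓡 4).tangent ∞
      (fun y => (⟨Φ ((extChartAt (𝓡 2) p₀).symm y), V ((extChartAt (𝓡 2) p₀).symm y)⟩ :
        TangentBundle (𝓡 4) N)) (mapDomain (n := 2) (m := 4) Φ p₀ z₀) :=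
    ContMDiff.comp_contMDiffOn (f := (extChartAt (𝓡 2) p₀).symm) hV
      ((contMDiffOn_extChartAt_symm p₀).mono inter_subset_left)
  rw [← contMDiffOn_iff_contDiffOn]
  refine ((((trivializationAt (Coord 4) (TangentSpace (𝓡 4)) z₀).contMDiffOn_iff
    fun y hy => ?_).1 hsmooth).2).congr fun y hy => (trivializationAt_snd hy.2 _).symm
  have hmem := hy.2
  rw [mem_preimage, mem_preimage, extChartAt_source] at hmem
  exact (Trivialization.mem_source _).2 hmem

lemma FieldAlong.Smooth.differentiableAt_fieldCoord (hΦ : Continuous Φ) {V : FieldAlong Φ}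
    (hV : V.Smooth) {p₀ : S} {z₀ : N} {y : Coord 2}
    (hy : y ∈ mapDomain (n := 2) (m := 4) Φ p₀ z₀) :
    DifferentiableAt ℝ (fieldCoord V p₀ z₀) y :=
  ((hV.contDiffOn_fieldCoord p₀ z₀).differentiableOn (by simp)).differentiableAt
    ((isOpen_mapDomain hΦ p₀ z₀).mem_nhds hy)

section SmoothMap

variable (hΦ : ContMDiff (𝓡 2) (𝓡 4) ∞ Φ) {p₀ : S} {z₀ : N} {y : Coord 2}
  (hy : y ∈ mapDomain (n := 2) (m := 4) Φ p₀ z₀)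
include hΦ

lemma contDiffOn_fderiv_mapCoord (p₀ : S) (z₀ : N) (c : Coord 2) :
    ContDiffOn ℝ ∞ (fun y => fderiv ℝ (mapCoord (m := 4) Φ p₀ z₀) y c)
      (mapDomain (n := 2) (m := 4) Φ p₀ z₀) :=
  ((contDiffOn_mapCoord (k := ⊤) hΦ p₀ z₀).fderiv_of_isOpen
    (isOpen_mapDomain hΦ.continuous p₀ z₀) (m := ∞) (by simp)).clm_apply contDiffOn_const

include hy

lemma differentiableAt_mapCoord : DifferentiableAt ℝ (mapCoord (m := 4) Φ p₀ z₀) y :=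
  (hasFDerivAt_mapCoord hy ((hΦ _).mdifferentiableAt (by simp))).differentiableAt

lemma comps_differential_frame (c : Coord 2) :
    comps z₀ _ (differential Φ _ (frame p₀ ((extChartAt (𝓡 2) p₀).symm y) c)) =
      fderiv ℝ (mapCoord (m := 4) Φ p₀ z₀) y c := by
  rw [(hasFDerivAt_mapCoord hy ((hΦ _).mdifferentiableAt (by simp))).fderiv]
  rfl

lemma bilinCoord_induced (g : LorentzMetric N) :
    bilinCoord (induced g Φ) p₀ y =
      pullbackForm (bilinCoord g.val z₀ (mapCoord Φ p₀ z₀ y))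
        (fderiv ℝ (mapCoord (m := 4) Φ p₀ z₀) y) := by
  ext c d
  rw [pullbackForm_apply, ← comps_differential_frame hΦ hy, ← comps_differential_frame hΦ hy,
    ← metric_apply_eq g hy]
  rfl

end SmoothMap

end LocalRepresentatives

/-! ### The Levi-Civita connection along a map -/

section CovariantDerivative

variable {N : Type*} [TopologicalSpace N] [ChartedSpace (Coord 4) N] [IsManifold (𝓡 4) ∞ N]
  {S : Type*} [TopologicalSpace S] [ChartedSpace (Coord 2) S]
  {g : LorentzMetric N} {Φ : S → N} {V W : FieldAlong Φ} {f : S → ℝ} {p₀ : S} {y : Coord 2}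

/-- Destructuring this with `rfl` expresses `p` in a chart, where rewriting `p` would fail because
the tangent spaces depend on it. -/
lemma exists_extChartAt_symm_eq (p : S) :
    ∃ p₀ y, y ∈ (extChartAt (𝓡 2) p₀).target ∧ (extChartAt (𝓡 2) p₀).symm y = p :=
  ⟨p, _, mem_extChartAt_target p, extChartAt_to_inv p⟩

lemma contMDiff_metric (hΦ : ContMDiff (𝓡 2) (𝓡 4) ∞ Φ) (hV : V.Smooth) (hW : W.Smooth) :
    ContMDiff (𝓡 2) 𝓘(ℝ, ℝ) ∞ fun p => g.val (Φ p) (V p) (W p) := fun p =>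
  (contMDiffAt_totalSpace.1 (ContMDiff.clm_bundle_apply₂ (F₁ := Coord 4) (F₂ := Coord 4) (F₃ := ℝ)
    (E₃ := Bundle.Trivial N ℝ) (g.smooth.comp hΦ) hV hW p)).2

variable [IsManifold (𝓡 2) ∞ S]

lemma metric_covDeriv_of_eq (hΦ : ContMDiff (𝓡 2) (𝓡 4) ∞ Φ) (hV : V.Smooth)
    (hy : y ∈ (extChartAt (𝓡 2) p₀).target) {z₀ : N}
    (hz₀ : z₀ = Φ ((extChartAt (𝓡 2) p₀).symm y))
    (w : TangentSpace (𝓡 4) (Φ ((extChartAt (𝓡 2) p₀).symm y))) (c : Coord 2) :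
    g.val _ w (covDeriv g Φ V _ (frame p₀ _ c)) =
      covDerivPairing (bilinCoord g.val z₀) (mapCoord Φ p₀ z₀) (fieldCoord V p₀ z₀) y c
        (comps z₀ _ w) := by
  subst hz₀
  set q := (extChartAt (𝓡 2) p₀).symm y
  have hyq : y ∈ mapDomain (n := 2) (m := 4) Φ p₀ (Φ q) := mem_mapDomain_self Φ hy
  have hfield : HasFDerivAt (fieldCoord V p₀ (Φ q))
      (mfderiv (𝓡 2) 𝓘(ℝ, Coord 4) (fun p => comps (Φ q) (Φ p) (V p)) q ∘L frame p₀ q :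
        Coord 2 →L[ℝ] Coord 4) y :=
    hasFDerivAt_comp_extChartAt_symm hy (hV.mdifferentiableAt_comps q)
  have hcov : comps (Φ q) (Φ q) (covDeriv g Φ V q (frame p₀ q c)) =
      fderiv ℝ (fieldCoord V p₀ (Φ q)) y c +
        christoffel g.val (Φ q) (fieldCoord V p₀ (Φ q) y)
          (fderiv ℝ (mapCoord (m := 4) Φ p₀ (Φ q)) y c) := by
    rw [hfield.fderiv,
      ← comps_differential_frame hΦ hyq]
    exact comps_frame (mem_extChartAt_source (I := 𝓡 4) (Φ q)) _
  have hchristoffel (a b d : Coord 4) :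
      bilinCoord g.val (Φ q) (mapCoord Φ p₀ (Φ q) y) a (christoffel g.val (Φ q) b d) =
        christoffelForm (fderiv ℝ (bilinCoord g.val (Φ q)) (mapCoord Φ p₀ (Φ q) y)) b d a := by
    rw [g.bilinCoord_symm]
    exact congrArg (fun l => l a) (g.bilinCoord_apply_inverse (mem_extChartAt_target (Φ q))
      (christoffelLower g.val (Φ q) b d))
  rw [metric_apply_eq g hyq, hcov, map_add, hchristoffel, covDerivPairing]

/-- `covDeriv` at `p` is defined in the chart around `Φ p`, which moves with `p`; its smoothness and
its algebraic properties are read off in a fixed chart. -/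
lemma metric_covDeriv (hΦ : ContMDiff (𝓡 2) (𝓡 4) ∞ Φ) (hV : V.Smooth) {z₀ : N}
    (hy : y ∈ mapDomain (n := 2) (m := 4) Φ p₀ z₀)
    (w : TangentSpace (𝓡 4) (Φ ((extChartAt (𝓡 2) p₀).symm y))) (c : Coord 2) :
    g.val _ w (covDeriv g Φ V _ (frame p₀ _ c)) =
      covDerivPairing (bilinCoord g.val z₀) (mapCoord Φ p₀ z₀) (fieldCoord V p₀ z₀) y c
        (comps z₀ _ w) := by
  obtain ⟨z₁, hz₁⟩ : ∃ z₁, z₁ = Φ ((extChartAt (𝓡 2) p₀).symm y) := ⟨_, rfl⟩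
  have hy₁ : y ∈ mapDomain (n := 2) (m := 4) Φ p₀ z₁ := hz₁ ▸ mem_mapDomain_self Φ hy.1
  have hoverlap : mapCoord Φ p₀ z₀ y ∈ overlap (n := 4) z₀ z₁ :=
    extChartAt_mem_mapDomain (f := id) hy.2 hy₁.2
  have hopen : IsOpen (overlap (n := 4) z₀ z₁) := isOpen_mapDomain continuous_id z₀ z₁
  have hdomains : ∀ᶠ y' in 𝓝 y, y' ∈ mapDomain (n := 2) (m := 4) Φ p₀ z₀ ∧
      y' ∈ mapDomain (n := 2) (m := 4) Φ p₀ z₁ :=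
    Filter.Eventually.and ((isOpen_mapDomain hΦ.continuous p₀ z₀).mem_nhds hy)
      ((isOpen_mapDomain hΦ.continuous p₀ z₁).mem_nhds hy₁)
  have hmap : mapCoord (m := 4) Φ p₀ z₁ =ᶠ[𝓝 y]
      fun y' => transition (n := 4) z₀ z₁ (mapCoord Φ p₀ z₀ y') :=
    hdomains.mono fun y' hy' =>
      (congrArg (extChartAt (𝓡 4) z₁) ((extChartAt (𝓡 4) z₀).left_inv hy'.1.2)).symm
  have hfield : fieldCoord V p₀ z₁ =ᶠ[𝓝 y] fun y' =>
      fderiv ℝ (transition (n := 4) z₀ z₁) (mapCoord Φ p₀ z₀ y') (fieldCoord V p₀ z₀ y') :=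
    hdomains.mono fun y' hy' => comps_eq_fderiv_transition hy'.1.2 hy'.2.2 _
  have hmetric : ∀ᶠ x in 𝓝 (mapCoord (m := 4) Φ p₀ z₀ y), bilinCoord g.val z₀ x =
      pullbackForm (bilinCoord g.val z₁ (transition (n := 4) z₀ z₁ x))
        (fderiv ℝ (transition (n := 4) z₀ z₁) x) := by
    filter_upwards [hopen.mem_nhds hoverlap] with x hx using bilinCoord_eq_pullbackForm g.val hx
  rw [metric_covDeriv_of_eq hΦ hV hy.1 hz₁, covDerivPairing_congr hmap hfield,
    comps_eq_fderiv_transition hy.2 hy₁.2 w]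
  exact covDerivPairing_comp (g.differentiableAt_bilinCoord hoverlap.1)
    (g.differentiableAt_bilinCoord (transition_mem_target hoverlap))
    ((contDiffOn_mapCoord (k := 2) contMDiff_id z₀ z₁).contDiffAt (hopen.mem_nhds hoverlap))
    (g.bilinCoord_symm z₁ _) hmetric (differentiableAt_mapCoord hΦ hy)
    (hV.differentiableAt_fieldCoord hΦ.continuous hy) c _

lemma FieldAlong.Smooth.smul (hΦ : ContMDiff (𝓡 2) (𝓡 4) ∞ Φ) (hV : V.Smooth)
    (hf : ContMDiff (𝓡 2) 𝓘(ℝ, ℝ) ∞ f) : FieldAlong.Smooth fun p => f p • V p :=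
  FieldAlong.smooth_of_contDiffOn hΦ fun p₀ z₀ =>
    (((contDiffOn_comp_extChartAt_symm (k := ⊤) hf p₀).mono inter_subset_left).smul
      (hV.contDiffOn_fieldCoord p₀ z₀)).congr fun _ _ => map_smul _ _ _

lemma FieldAlong.Smooth.add (hΦ : ContMDiff (𝓡 2) (𝓡 4) ∞ Φ) (hV : V.Smooth) (hW : W.Smooth) :
    FieldAlong.Smooth fun p => V p + W p :=
  FieldAlong.smooth_of_contDiffOn hΦ fun p₀ z₀ =>
    ((hV.contDiffOn_fieldCoord p₀ z₀).add (hW.contDiffOn_fieldCoord p₀ z₀)).congr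
      fun _ _ => map_add _ _ _

lemma FieldAlong.Smooth.sub (hΦ : ContMDiff (𝓡 2) (𝓡 4) ∞ Φ) (hV : V.Smooth) (hW : W.Smooth) :
    FieldAlong.Smooth fun p => V p - W p :=
  FieldAlong.smooth_of_contDiffOn hΦ fun p₀ z₀ =>
    ((hV.contDiffOn_fieldCoord p₀ z₀).sub (hW.contDiffOn_fieldCoord p₀ z₀)).congr
      fun _ _ => map_sub _ _ _

lemma metric_covDeriv_add (hΦ : ContMDiff (𝓡 2) (𝓡 4) ∞ Φ) (hV : V.Smooth) (hW : W.Smooth)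
    (p : S) (w : TangentSpace (𝓡 4) (Φ p)) (X : TangentSpace (𝓡 2) p) :
    g.val (Φ p) w (covDeriv g Φ (fun p => V p + W p) p X) =
      g.val (Φ p) w (covDeriv g Φ V p X) + g.val (Φ p) w (covDeriv g Φ W p X) := by
  obtain ⟨p₀, y, hy, rfl⟩ := exists_extChartAt_symm_eq p
  have hyz := mem_mapDomain_self (n := 2) (m := 4) Φ hy
  rw [← frame_comps ((extChartAt (𝓡 2) p₀).map_target hy) X, metric_covDeriv hΦ (hV.add hΦ hW) hyz,
    metric_covDeriv hΦ hV hyz, metric_covDeriv hΦ hW hyz,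
    ← covDerivPairing_add (hV.differentiableAt_fieldCoord hΦ.continuous hyz)
      (hW.differentiableAt_fieldCoord hΦ.continuous hyz)]
  exact covDerivPairing_congr .rfl (.of_forall fun _ => map_add _ _ _) _ _

lemma metric_covDeriv_smul (hΦ : ContMDiff (𝓡 2) (𝓡 4) ∞ Φ) (hV : V.Smooth)
    (hf : ContMDiff (𝓡 2) 𝓘(ℝ, ℝ) ∞ f) (p : S) (w : TangentSpace (𝓡 4) (Φ p))
    (X : TangentSpace (𝓡 2) p) :
    g.val (Φ p) w (covDeriv g Φ (fun p => f p • V p) p X) =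
      dForm f p X * g.val (Φ p) w (V p) + f p * g.val (Φ p) w (covDeriv g Φ V p X) := by
  obtain ⟨p₀, y, hy, rfl⟩ := exists_extChartAt_symm_eq p
  have hyz := mem_mapDomain_self (n := 2) (m := 4) Φ hy
  have hfy : HasFDerivAt (fun y => f ((extChartAt (𝓡 2) p₀).symm y))
      (formCoord (dForm f) p₀ y) y :=
    hasFDerivAt_comp_extChartAt_symm hy ((hf _).mdifferentiableAt (by simp))
  rw [← frame_comps ((extChartAt (𝓡 2) p₀).map_target hy) X, metric_covDeriv hΦ (hV.smul hΦ hf) hyz,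
    metric_covDeriv hΦ hV hyz, metric_apply_eq g hyz, ← formCoord_apply, ← hfy.fderiv]
  refine Eq.trans ?_ (covDerivPairing_smul (G := bilinCoord g.val _) (σ := mapCoord (m := 4) Φ p₀ _)
    hfy.differentiableAt (hV.differentiableAt_fieldCoord hΦ.continuous hyz) _ _)
  exact covDerivPairing_congr .rfl (.of_forall fun _ => map_smul _ _ _) _ _

lemma dForm_metric (hΦ : ContMDiff (𝓡 2) (𝓡 4) ∞ Φ) (hV : V.Smooth) (hW : W.Smooth) (p : S)
    (X : TangentSpace (𝓡 2) p) :
    dForm (fun p => g.val (Φ p) (V p) (W p)) p X =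
      g.val (Φ p) (W p) (covDeriv g Φ V p X) + g.val (Φ p) (V p) (covDeriv g Φ W p X) := by
  obtain ⟨p₀, y, hy, rfl⟩ := exists_extChartAt_symm_eq p
  obtain ⟨z₀, hyz⟩ : ∃ z₀, y ∈ mapDomain (n := 2) (m := 4) Φ p₀ z₀ := ⟨_, mem_mapDomain_self Φ hy⟩
  have hmetric : (fun y => g.val (Φ ((extChartAt (𝓡 2) p₀).symm y)) (V _) (W _)) =ᶠ[𝓝 y]
      fun y => bilinCoord g.val z₀ (mapCoord Φ p₀ z₀ y) (fieldCoord V p₀ z₀ y)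
        (fieldCoord W p₀ z₀ y) := by
    filter_upwards [(isOpen_mapDomain hΦ.continuous p₀ z₀).mem_nhds hyz] with y' hy'
      using metric_apply_eq g hy' _ _
  rw [← frame_comps ((extChartAt (𝓡 2) p₀).map_target hy) X, metric_covDeriv hΦ hV hyz,
    metric_covDeriv hΦ hW hyz, ← formCoord_apply,
    formCoord_dForm ((contMDiff_metric hΦ hV hW).of_le (by simp)) hy, hmetric.fderiv_eq]
  exact fderiv_metric_eq_covDerivPairing (G := bilinCoord g.val z₀)
    (σ := mapCoord (m := 4) Φ p₀ z₀) (V := fieldCoord V p₀ z₀) (W := fieldCoord W p₀ z₀)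
    (g.differentiableAt_bilinCoord ((extChartAt (𝓡 4) z₀).map_source hyz.2)) (g.bilinCoord_symm z₀)
    (differentiableAt_mapCoord hΦ hyz) (hV.differentiableAt_fieldCoord hΦ.continuous hyz)
    (hW.differentiableAt_fieldCoord hΦ.continuous hyz) _

end CovariantDerivative

/-! ### The normal bundle of a spacelike surface -/

section InducedMetric

variable {N : Type*} [TopologicalSpace N] [ChartedSpace (Coord 4) N] [IsManifold (𝓡 4) ∞ N]
  {S : Type*} [TopologicalSpace S] [ChartedSpace (Coord 2) S]
  {g : LorentzMetric N} {Φ : S → N} {V : FieldAlong Φ}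

lemma IsSpacelikeEmbedding.contMDiff (hΦ : IsSpacelikeEmbedding g Φ) :
    ContMDiff (𝓡 2) (𝓡 4) ∞ Φ :=
  hΦ.embedding.contMDiff

variable [IsManifold (𝓡 2) ∞ S]

lemma contDiffOn_bilinCoord_comp_mapCoord (g : LorentzMetric N) (hΦ : ContMDiff (𝓡 2) (𝓡 4) ∞ Φ)
    (p₀ : S) (z₀ : N) :
    ContDiffOn ℝ ∞ (fun y => bilinCoord g.val z₀ (mapCoord Φ p₀ z₀ y))
      (mapDomain (n := 2) (m := 4) Φ p₀ z₀) :=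
  (g.contDiffOn_bilinCoord z₀).comp (contDiffOn_mapCoord (k := ⊤) hΦ p₀ z₀)
    fun _ hy => (extChartAt (𝓡 4) z₀).map_source hy.2

lemma contDiffOn_bilinCoord_induced (g : LorentzMetric N) (hΦ : ContMDiff (𝓡 2) (𝓡 4) ∞ Φ)
    (p₀ : S) : ContDiffOn ℝ ∞ (bilinCoord (induced g Φ) p₀) (extChartAt (𝓡 2) p₀).target := by
  refine contDiffOn_target_of_mapDomain (n := 2) (m := 4) hΦ.continuous fun z₀ =>
    contDiffOn_clm_apply.2 fun c => contDiffOn_clm_apply.2 fun d => ?_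
  refine (((contDiffOn_bilinCoord_comp_mapCoord g hΦ p₀ z₀).clm_apply
    (contDiffOn_fderiv_mapCoord hΦ p₀ z₀ c)).clm_apply
    (contDiffOn_fderiv_mapCoord hΦ p₀ z₀ d)).congr fun y hy => ?_
  rw [bilinCoord_induced hΦ hy, pullbackForm_apply]

lemma IsSpacelikeEmbedding.isRiemannian_induced (hΦ : IsSpacelikeEmbedding g Φ) :
    IsRiemannian (induced g Φ) where
  symm _ _ _ := g.symm _ _ _
  pos := hΦ.spacelike
  contDiffOn p₀ := (contDiffOn_bilinCoord_induced g hΦ.contMDiff p₀).of_le (by simp)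

/-- The 1-form `X ↦ ⟨V, dΦ X⟩`, dual to the tangential part of a vector field `V` along `Φ`. -/
def tangentialForm (g : LorentzMetric N) (V : FieldAlong Φ) : OneForm 2 S := fun p =>
  (g.val (Φ p) (V p)) ∘L (differential Φ p)

lemma contDiffOn_formCoord_tangentialForm (hΦ : ContMDiff (𝓡 2) (𝓡 4) ∞ Φ) (hV : V.Smooth)
    (p₀ : S) :
    ContDiffOn ℝ ∞ (formCoord (tangentialForm g V) p₀) (extChartAt (𝓡 2) p₀).target := by
  refine contDiffOn_target_of_mapDomain (n := 2) (m := 4) hΦ.continuous fun z₀ =>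
    contDiffOn_clm_apply.2 fun c => ?_
  refine (((contDiffOn_bilinCoord_comp_mapCoord g hΦ p₀ z₀).clm_apply
    (hV.contDiffOn_fieldCoord p₀ z₀)).clm_apply
    (contDiffOn_fderiv_mapCoord hΦ p₀ z₀ c)).congr fun y hy => ?_
  rw [← comps_differential_frame hΦ hy]
  exact metric_apply_eq g hy _ _

lemma FieldAlong.Smooth.normalProj (hΦ : IsSpacelikeEmbedding g Φ) (hV : V.Smooth) :
    FieldAlong.Smooth fun p => normalProj g Φ p (V p) := by
  have hh := hΦ.isRiemannian_induced
  refine FieldAlong.smooth_of_contDiffOn hΦ.contMDiff fun p₀ z₀ => ?_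
  have hinverse : ContDiffOn ℝ ∞ (fun y => (bilinCoord (induced g Φ) p₀ y).inverse)
      (extChartAt (𝓡 2) p₀).target := fun y hy =>
    (contDiffAt_inverse_of_pos (hh.bilinCoord_pos hy)).comp_contDiffWithinAt y
      (contDiffOn_bilinCoord_induced g hΦ.contMDiff p₀ y hy)
  have hdifferential : ContDiffOn ℝ ∞ (fderiv ℝ (mapCoord (m := 4) Φ p₀ z₀))
      (mapDomain (n := 2) (m := 4) Φ p₀ z₀) :=
    contDiffOn_clm_apply.2 (contDiffOn_fderiv_mapCoord hΦ.contMDiff p₀ z₀)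
  refine ((hV.contDiffOn_fieldCoord p₀ z₀).sub (hdifferential.clm_apply ((hinverse.clm_apply
    (contDiffOn_formCoord_tangentialForm (g := g) hΦ.contMDiff hV p₀)).mono
      inter_subset_left))).congr fun y hy => ?_
  rw [← comps_differential_frame hΦ.contMDiff hy, hh.frame_inverse_formCoord _ hy.1]
  exact map_sub _ _ _

end InducedMetric

section NormalBundle

variable {N : Type*} [TopologicalSpace N] [ChartedSpace (Coord 4) N] [IsManifold (𝓡 4) ∞ N]
  {S : Type*} [TopologicalSpace S] [ChartedSpace (Coord 2) S]
  {g : LorentzMetric N} {Φ : S → N} {T : TimeOrientation g} {O : OutwardDirection g Φ}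
  {p : S} {v w : TangentSpace (𝓡 4) (Φ p)}

lemma IsNormal.smul (hw : IsNormal g Φ p w) (r : ℝ) : IsNormal g Φ p (r • w) := fun X => by
  rw [map_smul, smul_apply, hw X, smul_zero]

lemma IsNormal.add (hv : IsNormal g Φ p v) (hw : IsNormal g Φ p w) : IsNormal g Φ p (v + w) :=
  fun X => by rw [map_add, add_apply, hv X, hw X, add_zero]

lemma IsNormal.sub (hv : IsNormal g Φ p v) (hw : IsNormal g Φ p w) : IsNormal g Φ p (v - w) :=
  fun X => by rw [map_sub, sub_apply, hv X, hw X, sub_zero]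

lemma IsNormal.metric_normalProj (hw : IsNormal g Φ p w) (v : TangentSpace (𝓡 4) (Φ p)) :
    g.val (Φ p) w (normalProj g Φ p v) = g.val (Φ p) w v :=
  (map_sub (g.val (Φ p) w) v _).trans ((congrArg _ (hw _)).trans (sub_zero _))

lemma metric_normalProj_self_le (hΦ : IsSpacelikeEmbedding g Φ) (p : S)
    (v : TangentSpace (𝓡 4) (Φ p)) :
    g.val (Φ p) (normalProj g Φ p v) (normalProj g Φ p v) ≤ g.val (Φ p) v v := by
  obtain ⟨X, hX⟩ : ∃ X, v = normalProj g Φ p v + differential Φ p X :=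
    ⟨_, (sub_add_cancel _ _).symm⟩
  have hnormal := isNormal_normalProj hΦ p v
  have htangent : 0 ≤ g.val (Φ p) (differential Φ p X) (differential Φ p X) := by
    obtain rfl | hX := eq_or_ne X 0
    · simp only [map_zero, le_refl]
    · exact (hΦ.spacelike p X hX).le
  have hpythagoras : g.val (Φ p) v v = g.val (Φ p) (normalProj g Φ p v) (normalProj g Φ p v) +
      g.val (Φ p) (differential Φ p X) (differential Φ p X) := by
    generalize normalProj g Φ p v = w at hX hnormal
    rw [hX, map_add (g.val (Φ p)), add_apply, map_add, map_add, hnormal X,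
      g.symm (Φ p) (differential Φ p X) w, hnormal X, add_zero, zero_add]
  linarith

lemma inv_sqrt_mul_inv_sqrt_mul {r : ℝ} (hr : 0 < r) : (√ r)⁻¹ * ((√ r)⁻¹ * r) = 1 := by
  rw [← mul_assoc, ← mul_inv, Real.mul_self_sqrt hr.le, inv_mul_cancel₀ hr.ne']

lemma isNormal_refOut (O : OutwardDirection g Φ) (p : S) : IsNormal g Φ p (refOut O p) :=
  (O.normal p).smul _

lemma metric_refOut_self (O : OutwardDirection g Φ) (p : S) :
    g.val (Φ p) (refOut O p) (refOut O p) = 1 := by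
  rw [refOut, map_smul, map_smul, smul_apply, smul_eq_mul, smul_eq_mul]
  exact inv_sqrt_mul_inv_sqrt_mul (O.spacelike p)

lemma metric_refOut_pos_iff : 0 < g.val (Φ p) w (refOut O p) ↔ 0 < g.val (Φ p) w (O.field p) := by
  rw [refOut, map_smul, smul_eq_mul]
  exact mul_pos_iff_of_pos_left (inv_pos.2 (Real.sqrt_pos.2 (O.spacelike p)))

lemma isNormal_refTimeAux (hΦ : IsSpacelikeEmbedding g Φ) (T : TimeOrientation g)
    (O : OutwardDirection g Φ) (p : S) : IsNormal g Φ p (refTimeAux T O p) :=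
  (isNormal_normalProj hΦ p _).sub ((isNormal_refOut O p).smul _)

lemma metric_refTimeAux_refOut (T : TimeOrientation g) (O : OutwardDirection g Φ) (p : S) :
    g.val (Φ p) (refTimeAux T O p) (refOut O p) = 0 := by
  rw [refTimeAux, g.symm, map_sub, (isNormal_refOut O p).metric_normalProj, map_smul,
    metric_refOut_self, g.symm, smul_eq_mul, mul_one, sub_self]

lemma metric_refTimeAux_field (hΦ : IsSpacelikeEmbedding g Φ) (T : TimeOrientation g)
    (O : OutwardDirection g Φ) (p : S) :
    g.val (Φ p) (refTimeAux T O p) (T.field (Φ p)) =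
      g.val (Φ p) (refTimeAux T O p) (refTimeAux T O p) := by
  conv_rhs => arg 2; rw [refTimeAux]
  rw [map_sub, (isNormal_refTimeAux hΦ T O p).metric_normalProj, map_smul,
    metric_refTimeAux_refOut, smul_zero, sub_zero]

lemma metric_refTimeAux_self_neg (hΦ : IsSpacelikeEmbedding g Φ) (T : TimeOrientation g)
    (O : OutwardDirection g Φ) (p : S) :
    g.val (Φ p) (refTimeAux T O p) (refTimeAux T O p) < 0 := by
  set t := T.field (Φ p)
  calc g.val (Φ p) (refTimeAux T O p) (refTimeAux T O p)
      = g.val (Φ p) (normalProj g Φ p t) t -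
          g.val (Φ p) t (refOut O p) * g.val (Φ p) t (refOut O p) := by
        rw [← metric_refTimeAux_field hΦ, refTimeAux, map_sub, sub_apply, map_smul, smul_apply,
          smul_eq_mul, g.symm (Φ p) (refOut O p)]
    _ ≤ g.val (Φ p) (normalProj g Φ p t) t := sub_le_self _ (mul_self_nonneg _)
    _ = g.val (Φ p) (normalProj g Φ p t) (normalProj g Φ p t) :=
        ((isNormal_normalProj hΦ p t).metric_normalProj t).symm
    _ ≤ g.val (Φ p) t t := metric_normalProj_self_le hΦ p t
    _ < 0 := T.timelike (Φ p)

lemma isAdaptedFrame_ref (hΦ : IsSpacelikeEmbedding g Φ) (T : TimeOrientation g)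
    (O : OutwardDirection g Φ) (p : S) :
    IsAdaptedFrame T O p (refTime T O p) (refOut O p) := by
  have htimelike := metric_refTimeAux_self_neg hΦ T O p
  have hunit : g.val (Φ p) (refTime T O p) (refTime T O p) = -1 := by
    rw [refTime, map_smul, map_smul, smul_apply, smul_eq_mul, smul_eq_mul]
    linarith [inv_sqrt_mul_inv_sqrt_mul (neg_pos.2 htimelike)]
  exact {
    normal := (isNormal_refTimeAux hΦ T O p).smul _
    future := by
      refine ⟨by rw [hunit]; norm_num, ?_⟩
      rw [refTime, map_smul, smul_apply, metric_refTimeAux_field hΦ]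
      exact smul_neg_of_pos_of_neg (inv_pos.2 (Real.sqrt_pos.2 (neg_pos.2 htimelike))) htimelike
    outward := by
      refine ⟨isNormal_refOut O p, ?_, metric_refOut_pos_iff.1 ?_⟩ <;>
        exact (metric_refOut_self O p).symm ▸ one_pos
    unit_timelike := hunit
    unit_spacelike := metric_refOut_self O p
    orthogonal := by rw [refTime, map_smul, smul_apply, metric_refTimeAux_refOut, smul_zero] }

lemma isNormal_perp (hΦ : IsSpacelikeEmbedding g Φ) (T : TimeOrientation g)
    (O : OutwardDirection g Φ) (p : S) (w : TangentSpace (𝓡 4) (Φ p)) :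
    IsNormal g Φ p (perp T O p w) :=
  ((isAdaptedFrame_ref hΦ T O p).normal.smul _).sub ((isNormal_refOut O p).smul _)

lemma metric_smul_ref_add_smul_ref (hΦ : IsSpacelikeEmbedding g Φ) (T : TimeOrientation g)
    (O : OutwardDirection g Φ) (p : S) (a b c d : ℝ) :
    g.val (Φ p) (a • refOut O p + b • refTime T O p) (c • refOut O p + d • refTime T O p) =
      a * c - b * d := by
  have h := isAdaptedFrame_ref hΦ T O p
  have horthogonal : g.val (Φ p) (refOut O p) (refTime T O p) = 0 := by
    rw [g.symm, h.orthogonal]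
  simp only [map_add, map_smul, add_apply, smul_apply, smul_eq_mul, h.unit_timelike,
    h.unit_spacelike, h.orthogonal, horthogonal]
  ring

lemma perp_smul_ref_add_smul_ref (hΦ : IsSpacelikeEmbedding g Φ) (T : TimeOrientation g)
    (O : OutwardDirection g Φ) (p : S) (a b : ℝ) :
    perp T O p (a • refOut O p + b • refTime T O p) = b • refOut O p + a • refTime T O p := by
  have hout := metric_smul_ref_add_smul_ref hΦ T O p a b 1 0
  have htime := metric_smul_ref_add_smul_ref hΦ T O p a b 0 1
  rw [one_smul, zero_smul, add_zero] at hout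
  rw [one_smul, zero_smul, zero_add] at htime
  rw [perp, hout, htime]
  module

/-- The unit outward normal field at hyperbolic angle `θ` from the reference frame. -/
def hyperbolicNormal (T : TimeOrientation g) (O : OutwardDirection g Φ) (θ : S → ℝ) :
    FieldAlong Φ := fun p =>
  Real.cosh (θ p) • refOut O p + Real.sinh (θ p) • refTime T O p

lemma perp_hyperbolicNormal (hΦ : IsSpacelikeEmbedding g Φ) (T : TimeOrientation g)
    (O : OutwardDirection g Φ) (θ : S → ℝ) (p : S) :
    perp T O p (hyperbolicNormal T O θ p) =
      Real.sinh (θ p) • refOut O p + Real.cosh (θ p) • refTime T O p :=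
  perp_smul_ref_add_smul_ref hΦ T O p _ _

lemma connectionForm_apply (hΦ : IsSpacelikeEmbedding g Φ) (T : TimeOrientation g)
    (O : OutwardDirection g Φ) (ν : FieldAlong Φ) (p : S) (X : TangentSpace (𝓡 2) p) :
    connectionForm T O ν p X = g.val (Φ p) (perp T O p (ν p)) (covDeriv g Φ ν p X) :=
  (isNormal_perp hΦ T O p (ν p)).metric_normalProj _

lemma contMDiff_inv_sqrt {r : S → ℝ} (hr : ContMDiff (𝓡 2) 𝓘(ℝ, ℝ) ∞ r) (hpos : ∀ p, 0 < r p) :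
    ContMDiff (𝓡 2) 𝓘(ℝ, ℝ) ∞ fun p => (√ (r p))⁻¹ := fun p =>
  ContMDiffAt.comp (g := fun t : ℝ => (√ t)⁻¹) p
    ((Real.contDiffAt_sqrt (hpos p).ne').inv (Real.sqrt_pos.2 (hpos p)).ne').contMDiffAt (hr p)

variable [IsManifold (𝓡 2) ∞ S] {ν μ : FieldAlong Φ}

lemma smooth_refOut (hΦ : IsSpacelikeEmbedding g Φ) (O : OutwardDirection g Φ) :
    FieldAlong.Smooth fun p => refOut O p :=
  O.smooth.smul hΦ.contMDiff
    (contMDiff_inv_sqrt (contMDiff_metric hΦ.contMDiff O.smooth O.smooth) O.spacelike)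

lemma smooth_refTimeAux (hΦ : IsSpacelikeEmbedding g Φ) (T : TimeOrientation g)
    (O : OutwardDirection g Φ) : FieldAlong.Smooth fun p => refTimeAux T O p := by
  have hs := hΦ.contMDiff
  have hT : FieldAlong.Smooth fun p => T.field (Φ p) := T.smooth.comp hs
  have hO := smooth_refOut hΦ O
  exact (hT.normalProj hΦ).sub hs (hO.smul hs (contMDiff_metric hs hT hO))

lemma smooth_refTime (hΦ : IsSpacelikeEmbedding g Φ) (T : TimeOrientation g)
    (O : OutwardDirection g Φ) : FieldAlong.Smooth fun p => refTime T O p := by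
  have hs := hΦ.contMDiff
  have hA := smooth_refTimeAux hΦ T O
  exact hA.smul hs (contMDiff_inv_sqrt (contMDiff_metric hs hA hA).neg
    fun p => neg_pos.2 (metric_refTimeAux_self_neg hΦ T O p))

lemma FieldAlong.Smooth.perp (hΦ : IsSpacelikeEmbedding g Φ) (hν : ν.Smooth)
    (T : TimeOrientation g) (O : OutwardDirection g Φ) :
    FieldAlong.Smooth fun p => perp T O p (ν p) := by
  have hs := hΦ.contMDiff
  have hO := smooth_refOut hΦ O
  have hT := smooth_refTime hΦ T O
  exact (hT.smul hs (contMDiff_metric hs hν hO)).sub hs (hO.smul hs (contMDiff_metric hs hν hT))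

lemma isUnitOutwardNormal_hyperbolicNormal (hΦ : IsSpacelikeEmbedding g Φ) (T : TimeOrientation g)
    (O : OutwardDirection g Φ) {θ : S → ℝ} (hθ : ContMDiff (𝓡 2) 𝓘(ℝ, ℝ) ∞ θ) :
    IsUnitOutwardNormal O (hyperbolicNormal T O θ) := by
  have hs := hΦ.contMDiff
  have hunit (p) : g.val (Φ p) (hyperbolicNormal T O θ p) (hyperbolicNormal T O θ p) = 1 := by
    rw [hyperbolicNormal, metric_smul_ref_add_smul_ref hΦ]
    linarith [Real.cosh_sq (θ p)]
  refine ⟨?_, fun p => ⟨?_, ?_, ?_⟩, hunit⟩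
  · exact ((smooth_refOut hΦ O).smul hs (Real.contDiff_cosh.contMDiff.comp hθ)).add hs
      ((smooth_refTime hΦ T O).smul hs (Real.contDiff_sinh.contMDiff.comp hθ))
  · exact ((isNormal_refOut O p).smul _).add ((isAdaptedFrame_ref hΦ T O p).normal.smul _)
  · rw [hunit]
    exact one_pos
  · have hcosh := metric_smul_ref_add_smul_ref hΦ T O p (Real.cosh (θ p)) (Real.sinh (θ p)) 1 0
    rw [one_smul, zero_smul, add_zero, mul_one, mul_zero, sub_zero] at hcosh
    exact metric_refOut_pos_iff.1 (hcosh.symm ▸ Real.cosh_pos (θ p))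

lemma IsUnitOutwardNormal.exists_eq_hyperbolicNormal (hΦ : IsSpacelikeEmbedding g Φ)
    (T : TimeOrientation g) (hν : IsUnitOutwardNormal O ν) :
    ∃ θ : S → ℝ, ContMDiff (𝓡 2) 𝓘(ℝ, ℝ) ∞ θ ∧ ν = hyperbolicNormal T O θ := by
  refine ⟨fun p => Real.arsinh (-g.val (Φ p) (ν p) (refTime T O p)),
    Real.contDiff_arsinh.contMDiff.comp
      (contMDiff_metric hΦ.contMDiff hν.smooth (smooth_refTime hΦ T O)).neg, funext fun p => ?_⟩
  have hpos : 0 < g.val (Φ p) (ν p) (refOut O p) := metric_refOut_pos_iff.2 (hν.outward p).2.2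
  have hexpand := (isAdaptedFrame_ref hΦ T O p).expand hΦ (hν.outward p).1
  have hunit := hν.unit p
  rw [hyperbolicNormal, Real.cosh_arsinh, Real.sinh_arsinh]
  generalize g.val (Φ p) (ν p) (refOut O p) = a at hpos hexpand
  generalize g.val (Φ p) (ν p) (refTime T O p) = b at hexpand
  rw [sub_eq_add_neg, ← neg_smul] at hexpand
  rw [hexpand, metric_smul_ref_add_smul_ref hΦ] at hunit
  rw [show 1 + (-b) ^ 2 = a ^ 2 by linarith, Real.sqrt_sq hpos.le]
  exact hexpand

lemma isC1_connectionForm (hΦ : IsSpacelikeEmbedding g Φ) (T : TimeOrientation g)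
    (O : OutwardDirection g Φ) (hν : ν.Smooth) : OneForm.IsC1 (connectionForm T O ν) := by
  have hs := hΦ.contMDiff
  refine fun p₀ => contDiffOn_target_of_mapDomain (n := 2) (m := 4) hs.continuous fun z₀ =>
    contDiffOn_clm_apply.2 fun c => ?_
  have hpairing := contDiffOn_covDerivPairing (isOpen_extChartAt_target z₀)
    (isOpen_mapDomain hs.continuous p₀ z₀) (g.contDiffOn_bilinCoord z₀)
    (contDiffOn_mapCoord (k := ⊤) hs p₀ z₀) (fun _ hy => (extChartAt (𝓡 4) z₀).map_source hy.2)
    (hν.contDiffOn_fieldCoord p₀ z₀) ((hν.perp hΦ T O).contDiffOn_fieldCoord p₀ z₀) c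
  refine (hpairing.of_le (by simp)).congr fun y hy => ?_
  rw [formCoord_apply, connectionForm_apply hΦ, metric_covDeriv hs hν hy]
  rfl

lemma metric_covDeriv_eq_neg (hΦ : ContMDiff (𝓡 2) (𝓡 4) ∞ Φ) (hν : ν.Smooth) (hμ : μ.Smooth)
    {c : ℝ} (hc : ∀ p, g.val (Φ p) (ν p) (μ p) = c) (p : S) (X : TangentSpace (𝓡 2) p) :
    g.val (Φ p) (μ p) (covDeriv g Φ ν p X) = -g.val (Φ p) (ν p) (covDeriv g Φ μ p X) := by
  have h := dForm_metric (g := g) hΦ hν hμ p X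
  simp only [hc] at h
  rw [show dForm (n := 2) (fun _ : S => c) p = 0 from mfderiv_const, zero_apply] at h
  exact eq_neg_of_add_eq_zero_left h.symm

lemma metric_covDeriv_hyperbolicNormal (hΦ : IsSpacelikeEmbedding g Φ)
    (T : TimeOrientation g) (O : OutwardDirection g Φ) {θ : S → ℝ}
    (hθ : ContMDiff (𝓡 2) 𝓘(ℝ, ℝ) ∞ θ) (p : S) (w : TangentSpace (𝓡 4) (Φ p))
    (X : TangentSpace (𝓡 2) p) :
    g.val (Φ p) w (covDeriv g Φ (hyperbolicNormal T O θ) p X) =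
      dForm θ p X * g.val (Φ p) w (perp T O p (hyperbolicNormal T O θ p)) +
        (Real.cosh (θ p) * g.val (Φ p) w (covDeriv g Φ (fun p => refOut O p) p X) +
          Real.sinh (θ p) * g.val (Φ p) w (covDeriv g Φ (fun p => refTime T O p) p X)) := by
  have hs := hΦ.contMDiff
  have hout := smooth_refOut hΦ O
  have htime := smooth_refTime hΦ T O
  have hcosh : ContMDiff (𝓡 2) 𝓘(ℝ, ℝ) ∞ fun p => Real.cosh (θ p) :=
    Real.contDiff_cosh.contMDiff.comp hθ
  have hsinh : ContMDiff (𝓡 2) 𝓘(ℝ, ℝ) ∞ fun p => Real.sinh (θ p) :=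
    Real.contDiff_sinh.contMDiff.comp hθ
  have hθp : MDifferentiableAt (𝓡 2) 𝓘(ℝ, ℝ) θ p := (hθ p).mdifferentiableAt (by simp)
  rw [perp_hyperbolicNormal hΦ, map_add, map_smul, map_smul, smul_eq_mul, smul_eq_mul]
  refine (metric_covDeriv_add hs (hout.smul hs hcosh) (htime.smul hs hsinh) p w X).trans ?_
  rw [metric_covDeriv_smul hs hout hcosh, metric_covDeriv_smul hs htime hsinh,
    dForm_comp_apply (Real.hasDerivAt_cosh _) hθp, dForm_comp_apply (Real.hasDerivAt_sinh _) hθp]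
  ring

lemma connectionForm_hyperbolicNormal (hΦ : IsSpacelikeEmbedding g Φ) (T : TimeOrientation g)
    (O : OutwardDirection g Φ) {θ : S → ℝ} (hθ : ContMDiff (𝓡 2) 𝓘(ℝ, ℝ) ∞ θ) :
    connectionForm T O (hyperbolicNormal T O θ) =
      connectionForm T O (fun p => refOut O p) - dForm θ := by
  have hs := hΦ.contMDiff
  have hout := smooth_refOut hΦ O
  have htime := smooth_refTime hΦ T O
  have hframe := isAdaptedFrame_ref hΦ T O
  funext p
  refine ContinuousLinearMap.ext fun X => ?_
  have hsub : (connectionForm T O (fun p => refOut O p) - dForm θ : OneForm 2 S) p X =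
      connectionForm T O (fun p => refOut O p) p X - dForm θ p X := rfl
  have hunit : g.val (Φ p) (perp T O p (hyperbolicNormal T O θ p))
      (perp T O p (hyperbolicNormal T O θ p)) = -1 := by
    rw [perp_hyperbolicNormal hΦ, metric_smul_ref_add_smul_ref hΦ]
    linarith [Real.cosh_sq (θ p)]
  have hoo := metric_covDeriv_eq_neg hs hout hout (fun p => (hframe p).unit_spacelike) p X
  have htt := metric_covDeriv_eq_neg hs htime htime (fun p => (hframe p).unit_timelike) p X
  have hto := metric_covDeriv_eq_neg hs htime hout (fun p => (hframe p).orthogonal) p X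
  rw [hsub, connectionForm_apply hΦ, connectionForm_apply hΦ, (perp_adapted hΦ (hframe p)).2,
    metric_covDeriv_hyperbolicNormal hΦ T O hθ, hunit, perp_hyperbolicNormal hΦ]
  simp only [map_add, map_smul, add_apply, smul_apply, smul_eq_mul]
  rw [hto, self_eq_neg.1 hoo, self_eq_neg.1 htt]
  linear_combination g.val (Φ p) (refTime T O p) (covDeriv g Φ (fun p => refOut O p) p X) *
    Real.cosh_sq (θ p)

lemma connectionForm_hyperbolicNormal_add (hΦ : IsSpacelikeEmbedding g Φ) (T : TimeOrientation g)
    (O : OutwardDirection g Φ) {θ f : S → ℝ} (hθ : ContMDiff (𝓡 2) 𝓘(ℝ, ℝ) ∞ θ)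
    (hf : ContMDiff (𝓡 2) 𝓘(ℝ, ℝ) ∞ f) :
    connectionForm T O (hyperbolicNormal T O (θ + f)) =
      connectionForm T O (hyperbolicNormal T O θ) - dForm f := by
  have hdForm : dForm (n := 2) (θ + f) = dForm θ + dForm f := funext fun p =>
    dForm_add ((hθ p).mdifferentiableAt (by simp)) ((hf p).mdifferentiableAt (by simp))
  rw [connectionForm_hyperbolicNormal hΦ T O (hθ.add hf), connectionForm_hyperbolicNormal hΦ T O hθ,
    hdForm, sub_sub]

end NormalBundle

end StraightOut

end

theorem proposition3p1_general
    {N : Type*} [TopologicalSpace N]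
    [ChartedSpace (StraightOut.Coord 4) N] [IsManifold (𝓡 4) ∞ N]
    {S : Type*} [TopologicalSpace S] [T2Space S] [CompactSpace S]
    [ChartedSpace (StraightOut.Coord 2) S] [IsManifold (𝓡 2) ∞ S]
    [MeasurableSpace S] [BorelSpace S]
    (g : StraightOut.LorentzMetric N) (T : StraightOut.TimeOrientation g)
    (Φ : S → N) (hΦ : StraightOut.IsSpacelikeEmbedding g Φ)
    (O : StraightOut.OutwardDirection g Φ)
    (ν : StraightOut.FieldAlong Φ) (hν : StraightOut.IsUnitOutwardNormal O ν) :
    (∀ μ : StraightOut.FieldAlong Φ, StraightOut.IsUnitOutwardNormal O μ →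
        StraightOut.energy T O ν ≤ StraightOut.energy T O μ) ↔
      ∀ p : S, StraightOut.divergence (StraightOut.induced g Φ)
        (StraightOut.connectionForm T O ν) p = 0 := by
  rw [← hΦ.isRiemannian_induced.forall_integral_normSq_le_iff
    (StraightOut.isC1_connectionForm hΦ T O hν.smooth)]
  obtain ⟨θ, hθ, rfl⟩ := hν.exists_eq_hyperbolicNormal hΦ T
  constructor
  · intro hmin f hf
    rw [← StraightOut.connectionForm_hyperbolicNormal_add hΦ T O hθ hf]
    exact hmin _ (StraightOut.isUnitOutwardNormal_hyperbolicNormal hΦ T O (hθ.add hf))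
  · intro hmin μ hμ
    obtain ⟨θ', hθ', rfl⟩ := hμ.exists_eq_hyperbolicNormal hΦ T
    have hf : ContMDiff (𝓡 2) 𝓘(ℝ, ℝ) ∞ (θ' - θ) := hθ'.sub hθ
    have hle := hmin _ hf
    rwa [← StraightOut.connectionForm_hyperbolicNormal_add hΦ T O hθ hf, add_sub_cancel] at hle

theorem proposition3p1
    {N : Type*} [TopologicalSpace N] [T2Space N] [SecondCountableTopology N]
    [ChartedSpace (StraightOut.Coord 4) N] [IsManifold (𝓡 4) ∞ N]
    {S : Type*} [TopologicalSpace S] [T2Space S] [CompactSpace S]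
    [ChartedSpace (StraightOut.Coord 2) S] [IsManifold (𝓡 2) ∞ S]
    [MeasurableSpace S] [BorelSpace S]
    (g : StraightOut.LorentzMetric N) (T : StraightOut.TimeOrientation g)
    (Φ : S → N) (hΦ : StraightOut.IsSpacelikeEmbedding g Φ)
    (O : StraightOut.OutwardDirection g Φ)
    (ν : StraightOut.FieldAlong Φ) (hν : StraightOut.IsUnitOutwardNormal O ν) :
    (∀ μ : StraightOut.FieldAlong Φ, StraightOut.IsUnitOutwardNormal O μ →
        StraightOut.energy T O ν ≤ StraightOut.energy T O μ) ↔
      ∀ p : S, StraightOut.divergence (StraightOut.induced g Φ)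
        (StraightOut.connectionForm T O ν) p = 0 :=
  proposition3p1_general g T Φ hΦ O ν hν
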